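/- Identify real functions on the circle $S^1$ with $2\pi$-periodic functions on $\mathbb R$. For a sequence $M=(M_k)_{k\ge 0}$ of positive reals let $C^{\{M\}}(\mathbb R)$ (Roumieu type), respectively $C^{(M)}(\mathbb R)$ (Beurling type), be the set of $f\in C^\infty(\mathbb R)$ such that for every compact $K\subset\mathbb R$ the set $$\Big\{\frac{f^{(k)}(x)}{\rho^k\,k!\,M_k} : x\in K,\ k\in\mathbb N\Big\}$$ is bounded for some $\rho>0$, respectively for every $\rho>0$. Assume that $M$ is log-convex, $M_k^2\le M_{k-1}M_{k+1}$ for all $k\ge1$, and has moderate growth, $\sup_{j,k\ge 1}\big(M_{j+k}/(M_jM_k)\big)^{1/(j+k)}<\infty$; in the Beurling case assume also $M_k^{1/k}\to\infty$. Let $C^\circ(S^1)$ denote the space of real-valued $2\pi$-periodic functions of one of the following types: smooth, real-analytic, $C^{\{M\}}$, or $C^{(M)}$. A solution of the periodic Hunter–Saxton equation on an open interval $I\ni 0$ is a function $u(t,x)$, smooth on $I\times\mathbb R$ and $2\pi$-periodic in $x$, with $$u_{txx}+2u_xu_{xx}+u\,u_{xxx}=0 .$$ **Theorem (solutions to the periodic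 HS equation).** Let $u_0\in C^\circ(S^1)$. 1. The solution with initial value $u_0$ exists locally and stays in the same space: there are $T>0$ and a solution $u$ on $(-T,T)$ with $u(0,\cdot)=u_0$ and $u(t,\cdot)\in C^\circ(S^1)$ for all $t\in(-T,T)$; and every solution $u$ on an open interval $I\ni0$ with $u(0,\cdot)=u_0$ satisfies $u(t,\cdot)\in C^\circ(S^1)$ for all $t\in I$. 2. The solution is unique modulo time-dependent rotations: if $u,v$ are solutions on an open interval $I\ni 0$ with $u(0,\cdot)=v(0,\cdot)=u_0$, then there is a smooth $c:I\to\mathbb R$ with $c(0)=0$ and $v(t,x)=u(t,x-c(t))+c'(t)$ for all $t\in I$, $x\in\mathbb R$. 3. A solution with initial value $u_0$ and values in $C^\circ(S^1)$ exists for all times $t\in\mathbb R$ if and only if $u_0'(x)\ge 0$ for all $x$. Likewise, such a solution exists on an interval $(a,\infty)$ for some $a<0$ if and only if $u_0'(x)\ge0$ for all $x$. -/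

import Mathlib

open Set Filter
open scoped ContDiff Nat

/-- The standing assumptions on a weight sequence `M = (M_k)`: positive terms, logarithmic convexity
`M_k ^ 2 ≤ M_{k-1} M_{k+1}` for `k ≥ 1`, and moderate growth
`sup_{j,k ≥ 1} (M_{j+k} / (M_j M_k)) ^ (1/(j+k)) < ∞`. -/
structure IsWeightSequence (M : ℕ → ℝ) : Prop where
  pos : ∀ k, 0 < M k
  log_convex : ∀ k, M (k + 1) ^ 2 ≤ M k * M (k + 2)
  moderate_growth : ∃ C : ℝ, ∀ j k : ℕ, 0 < j → 0 < k →
    (M (j + k) / (M j * M k)) ^ (1 / ((j : ℝ) + (k : ℝ))) ≤ C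

/-- For fixed `ρ`, the set `{f⁽ᵏ⁾(x) / (ρ ^ k k! M_k) : x ∈ K, k ∈ ℕ}` is bounded. -/
def DenjoyCarlemanBounded (M : ℕ → ℝ) (f : ℝ → ℝ) (K : Set ℝ) (ρ : ℝ) : Prop :=
  ∃ C : ℝ, ∀ x ∈ K, ∀ k : ℕ, |iteratedDeriv k f x| / (ρ ^ k * (k ! : ℝ) * M k) ≤ C

/-- The Denjoy–Carleman class of Beurling type `C^{(M)}(ℝ)`. -/
def IsBeurling (M : ℕ → ℝ) (f : ℝ → ℝ) : Prop :=
  ContDiff ℝ ∞ f ∧ ∀ K : Set ℝ, IsCompact K → ∀ ρ : ℝ, 0 < ρ → DenjoyCarlemanBounded M f K ρ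

/-- The Denjoy–Carleman class of Roumieu type `C^{{M}}(ℝ)`. -/
def IsRoumieu (M : ℕ → ℝ) (f : ℝ → ℝ) : Prop :=
  ContDiff ℝ ∞ f ∧ ∀ K : Set ℝ, IsCompact K → ∃ ρ : ℝ, 0 < ρ ∧ DenjoyCarlemanBounded M f K ρ

/-- The regularity classes under consideration. -/
inductive RegularityClass where
  | smooth : RegularityClass
  | analytic : RegularityClass
  | beurling (M : ℕ → ℝ) : RegularityClass
  | roumieu (M : ℕ → ℝ) : RegularityClass

namespace RegularityClass

/-- The assumptions on the weights: none for smooth and real-analytic functions; in the Beurling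
case the requirement `M_k ^ (1/k) → ∞` is added. -/
def Admissible : RegularityClass → Prop
  | smooth => True
  | analytic => True
  | beurling M => IsWeightSequence M ∧
      Tendsto (fun k : ℕ => M k ^ (1 / (k : ℝ))) atTop atTop
  | roumieu M => IsWeightSequence M

/-- The function `f : ℝ → ℝ` has the given regularity. -/
def Mem : RegularityClass → (ℝ → ℝ) → Prop
  | smooth, f => ContDiff ℝ ∞ f
  | analytic, f => ∀ x, AnalyticAt ℝ f x
  | beurling M, f => IsBeurling M f
  | roumieu M, f => IsRoumieu M f

/-- Real functions on the circle of the given regularity, as `2π`-periodic functions on `ℝ`. -/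
def MemCircle (𝓒 : RegularityClass) (f : ℝ → ℝ) : Prop :=
  Function.Periodic f (2 * Real.pi) ∧ 𝓒.Mem f

end RegularityClass

/-- `u = u(t, x)` is a smooth solution, on the open set `I` of times, of the Hunter–Saxton equation
`u_{txx} + 2 u_x u_{xx} + u u_{xxx} = 0` on the circle, i.e. `2π`-periodic in `x`. -/
structure IsPeriodicHSSolution (I : Set ℝ) (u : ℝ → ℝ → ℝ) : Prop where
  smooth : ContDiffOn ℝ ∞ (fun p : ℝ × ℝ => u p.1 p.2) (I ×ˢ univ)
  periodic : ∀ t ∈ I, Function.Periodic (u t) (2 * Real.pi)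
  equation : ∀ t ∈ I, ∀ x : ℝ,
    deriv (fun s => iteratedDeriv 2 (u s) x) t
      + 2 * deriv (u t) x * iteratedDeriv 2 (u t) x
      + u t x * iteratedDeriv 3 (u t) x = 0

/-! Integrating the equation once in x gives u_tx + u u_xx + u_x²/2 = R(t). Integrating again over a
period gives R = -(1/4π)∫u_x², and this energy is conserved, so R = -2κ with κ = `hsFreq u₀`. Along
characteristics X_t = u(t, X) the slope v = u_x(t, X) therefore solves the Riccati equation v' +
v²/2 = -2κ. The substitution v = 2y'/y turns it into y'' = -κy with y(0) = 1, y'(0) = u₀'/2, and ∂ₓX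
= y². Thus y (`hsJac`) is explicit and affine in u₀'.

As long as a solution exists, y stays positive (`IsFlow.hsJac_pos`) and u₀ determines its flow up to
the motion of one point (`IsFlow.eq_hsFlow`); this is uniqueness modulo rotations. Conversely, where
y > 0 the explicit flow defines a solution (`isPeriodicHSSolution_hsSolution`). If u₀' < 0
somewhere, y fails to be positive at some later time; if u₀' ≥ 0, periodicity makes u₀ constant and
y = 1 for ever.

For regularity, u_x(t, X) = 2y'/y is a quotient of functions affine in u₀', and differentiation in
the variable X is the derivation y⁻²∂ₓ. If a supermultiplicative sequence Q dominates the Taylor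
coefficients of u₀' of positive order, iterating this derivation bounds the k-th derivative of u_x
by E k! S^k Q_k, with E and S independent of Q (`IsTransport.exists_bound`). Log-convexity of M
supplies such Q, and moderate growth pays for the passage from u₀ to u₀'. The inverse of X is never
estimated. Real-analytic functions are the Roumieu case M = 1. -/

/-! ### Power series with supermultiplicative coefficient bounds -/

/-- Supermultiplicative sequences `Q` of nonnegative reals with `Q 0 = 1`. -/
structure IsSupermul (Q : ℕ → ℝ) : Prop where
  zero : Q 0 = 1
  nonneg : ∀ k, 0 ≤ Q k
  mul_le : ∀ i j, Q i * Q j ≤ Q (i + j)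

theorem IsSupermul.pow_mul {Q : ℕ → ℝ} (hQ : IsSupermul Q) {r : ℝ} (hr : 0 ≤ r) :
    IsSupermul fun k => r ^ k * Q k where
  zero := by simp [hQ.zero]
  nonneg k := mul_nonneg (pow_nonneg hr k) (hQ.nonneg k)
  mul_le i j := by
    calc r ^ i * Q i * (r ^ j * Q j) = r ^ (i + j) * (Q i * Q j) := by ring
      _ ≤ _ := by have := hQ.mul_le i j; gcongr

/-- Each of the k + 1 terms is at most A B Q_k. Bounding their number by 2^k keeps the majorant a
geometric factor times Q, hence supermultiplicative. -/
theorem IsSupermul.conv_le {Q a b : ℕ → ℝ} (hQ : IsSupermul Q) {A B : ℝ} (hA : 0 ≤ A)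
    (ha : ∀ k, |a k| ≤ A * Q k) (hb : ∀ k, |b k| ≤ B * Q k) (k : ℕ) :
    |∑ p ∈ Finset.HasAntidiagonal.antidiagonal k, a p.1 * b p.2| ≤ A * B * (2 ^ k * Q k) := by
  have hB : 0 ≤ B := by simpa [hQ.zero] using (abs_nonneg _).trans (hb 0)
  calc |∑ p ∈ Finset.HasAntidiagonal.antidiagonal k, a p.1 * b p.2|
      ≤ ∑ p ∈ Finset.HasAntidiagonal.antidiagonal k, |a p.1 * b p.2| := Finset.abs_sum_le_sum_abs _ _
    _ ≤ ∑ p ∈ Finset.HasAntidiagonal.antidiagonal k, A * B * Q k := by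
        refine Finset.sum_le_sum fun p hp => ?_
        rw [abs_mul]
        calc |a p.1| * |b p.2| ≤ (A * Q p.1) * (B * Q p.2) := by
              have := hQ.nonneg p.1
              exact mul_le_mul (ha _) (hb _) (abs_nonneg _) (by positivity)
          _ = A * B * (Q p.1 * Q p.2) := by ring
          _ ≤ A * B * Q k := by
              have := hQ.mul_le p.1 p.2
              rw [Finset.HasAntidiagonal.mem_antidiagonal.1 hp] at this
              gcongr
    _ = ((k + 1 : ℕ) : ℝ) * (A * B * Q k) := by simp
    _ ≤ 2 ^ k * (A * B * Q k) := by
        have h1 : ((k + 1 : ℕ) : ℝ) ≤ 2 ^ k := by exact_mod_cast Nat.lt_two_pow_self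
        have := hQ.nonneg k
        gcongr
    _ = _ := by ring

/-- Coefficient bounds for the reciprocal of a power series. -/
theorem IsSupermul.inv_le {Q y h : ℕ → ℝ} (hQ : IsSupermul Q) {D H : ℝ} (hD : 0 < D)
    (hy : ∀ k, |y k| ≤ D * Q k) (h0 : |h 0| ≤ H) (hy0 : y 0 * h 0 = 1)
    (hyh : ∀ k, ∑ p ∈ Finset.HasAntidiagonal.antidiagonal (k + 1), y p.1 * h p.2 = 0) (k : ℕ) :
    |h k| ≤ H * ((1 + D * H) ^ k * Q k) := by
  have hne : h 0 ≠ 0 := right_ne_zero_of_mul_eq_one hy0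
  have hH : 0 < H := (abs_pos.2 hne).trans_le h0
  -- With R - 1 = D H the geometric sum in the recursion telescopes, so the induction closes without
  -- loss.
  set R := 1 + D * H with hR
  have hDH : 0 < D * H := by positivity
  induction k using Nat.strong_induction_on with
  | _ k ih =>
    rcases k with _ | k
    · simpa [hQ.zero] using h0
    have e : h (k + 1) = - (h 0 * ∑ i ∈ Finset.range (k + 1), y (i + 1) * h (k - i)) := by
      have h1 := hyh k
      rw [Finset.Nat.sum_antidiagonal_eq_sum_range_succ (fun i j => y i * h j),
        Finset.sum_range_succ'] at h1
      simp only [Nat.add_sub_add_right, Nat.sub_zero] at h1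
      linear_combination h 0 * h1 - h (k + 1) * hy0
    have hs : |∑ i ∈ Finset.range (k + 1), y (i + 1) * h (k - i)|
        ≤ ∑ i ∈ Finset.range (k + 1), D * H * Q (k + 1) * R ^ (k - i) := by
      refine (Finset.abs_sum_le_sum_abs _ _).trans (Finset.sum_le_sum fun i hi => ?_)
      have hik : i ≤ k := Nat.lt_succ_iff.1 (Finset.mem_range.1 hi)
      rw [abs_mul]
      calc |y (i + 1)| * |h (k - i)| ≤ (D * Q (i + 1)) * (H * (R ^ (k - i) * Q (k - i))) := by
            have := hQ.nonneg (i + 1)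
            exact mul_le_mul (hy _) (ih _ (by omega)) (abs_nonneg _) (by positivity)
        _ = D * H * (Q (i + 1) * Q (k - i)) * R ^ (k - i) := by ring
        _ ≤ _ := by
            have := hQ.mul_le (i + 1) (k - i)
            rw [show i + 1 + (k - i) = k + 1 by omega] at this
            have : 0 ≤ R := by positivity
            gcongr
    have hg : ∑ i ∈ Finset.range (k + 1), D * H * Q (k + 1) * R ^ (k - i)
        = Q (k + 1) * (R ^ (k + 1) - 1) := by
      rw [← Finset.mul_sum]
      have := Finset.sum_range_reflect (fun i => R ^ i) (k + 1)
      simp only [Nat.add_sub_cancel] at this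
      rw [this]
      have := geom_sum_mul R (k + 1)
      rw [← this, hR]; ring
    rw [e, abs_neg, abs_mul]
    calc |h 0| * _ ≤ H * (Q (k + 1) * (R ^ (k + 1) - 1)) := by
          rw [← hg]; exact mul_le_mul h0 hs (abs_nonneg _) hH.le
      _ ≤ _ := by
          have := hQ.nonneg (k + 1)
          have : 0 ≤ H * Q (k + 1) := by positivity
          nlinarith

theorem prod_odd_le (k : ℕ) : ∏ i ∈ Finset.range k, (2 * i + 1) ≤ 2 ^ k * k ! := by
  induction k with
  | zero => simp
  | succ k ih =>
    rw [Finset.prod_range_succ, Nat.factorial_succ, pow_succ]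
    calc _ ≤ (2 ^ k * k !) * (2 * k + 2) := by gcongr; omega
      _ = _ := by ring

/-- Hockey-stick summation after (b+1) C(b+1+2k, 2k) = (2k+1) C(b+1+2k, 2k+1). It is the coefficient
form of the extremal case of `IsSupermul.derivation_le`: applying (1-z)⁻¹ d/dz k times to (1-z)⁻¹
gives (2k-1)!! (1-z)^(-2k-1). -/
theorem sum_succ_mul_choose (k j : ℕ) :
    ∑ b ∈ Finset.range (j + 1), (b + 1) * (b + 1 + 2 * k).choose (2 * k)
      = (2 * k + 1) * (j + 2 * (k + 1)).choose (2 * (k + 1)) := by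
  have h := Nat.sum_range_add_choose j (2 * k + 1)
  rw [show j + 2 * (k + 1) = j + (2 * k + 1) + 1 by ring, show 2 * (k + 1) = 2 * k + 1 + 1 by ring,
    ← h, Finset.mul_sum]
  refine Finset.sum_congr rfl fun b _ => ?_
  have := Nat.choose_succ_right_eq (b + 1 + 2 * k) (2 * k)
  rw [show b + 1 + 2 * k - 2 * k = b + 1 by omega] at this
  rw [show b + (2 * k + 1) = b + 1 + 2 * k by ring]
  linarith

/-- Coefficient bounds for the iterates of a derivation `g ∂` on power series. -/
theorem IsSupermul.derivation_le {Q g : ℕ → ℝ} {F : ℕ → ℕ → ℝ} (hQ : IsSupermul Q) {A G : ℝ}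
    (hA : 0 ≤ A) (hG : 0 ≤ G) (hg : ∀ k, |g k| ≤ G * Q k) (h0 : ∀ k, |F 0 k| ≤ A * Q k)
    (hF : ∀ k j, F (k + 1) j
      = ∑ p ∈ Finset.HasAntidiagonal.antidiagonal j, g p.1 * ((p.2 + 1) * F k (p.2 + 1))) (k j : ℕ) :
    |F k j| ≤ A * G ^ k * (∏ i ∈ Finset.range k, (2 * i + 1) : ℕ)
      * ((j + 2 * k).choose (2 * k) : ℕ) * Q (j + k) := by
  induction k generalizing j with
  | zero => simpa using h0 j
  | succ k ih =>
    rw [hF, Finset.prod_range_succ]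
    set c := ∏ i ∈ Finset.range k, (2 * i + 1)
    calc _ ≤ ∑ p ∈ Finset.HasAntidiagonal.antidiagonal j, |g p.1 * ((p.2 + 1) * F k (p.2 + 1))| :=
          Finset.abs_sum_le_sum_abs _ _
      _ ≤ ∑ p ∈ Finset.HasAntidiagonal.antidiagonal j, A * G ^ (k + 1) * c * Q (j + (k + 1)) *
            (((p.2 + 1) * (p.2 + 1 + 2 * k).choose (2 * k) : ℕ) : ℝ) := by
          refine Finset.sum_le_sum fun p hp => ?_
          have hp' := Finset.HasAntidiagonal.mem_antidiagonal.1 hp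
          have h2 : |(p.2 : ℝ) + 1| = (p.2 : ℝ) + 1 := abs_of_nonneg (by positivity)
          rw [abs_mul, abs_mul, h2]
          have hq := hQ.mul_le p.1 (p.2 + 1 + k)
          rw [show p.1 + (p.2 + 1 + k) = j + (k + 1) by omega] at hq
          have hq1 := hQ.nonneg p.1
          have hq2 := hQ.nonneg (p.2 + 1 + k)
          calc |g p.1| * (((p.2 : ℝ) + 1) * |F k (p.2 + 1)|)
              ≤ (G * Q p.1) * (((p.2 : ℝ) + 1) * (A * G ^ k * c
                * ((p.2 + 1 + 2 * k).choose (2 * k) : ℕ) * Q (p.2 + 1 + k))) := by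
                have := ih (p.2 + 1)
                have := hg p.1
                gcongr
            _ = A * G ^ (k + 1) * c * (Q p.1 * Q (p.2 + 1 + k)) *
              (((p.2 + 1) * (p.2 + 1 + 2 * k).choose (2 * k) : ℕ) : ℝ) := by push_cast; ring
            _ ≤ _ := by gcongr
      _ = _ := by
          rw [← Finset.mul_sum, ← Finset.Nat.sum_antidiagonal_swap]
          simp only [Prod.snd_swap]
          rw [Finset.Nat.sum_antidiagonal_eq_sum_range_succ
            (fun i _ => (((i + 1) * (i + 1 + 2 * k).choose (2 * k) : ℕ) : ℝ)),
            ← Nat.cast_sum, sum_succ_mul_choose]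
          push_cast
          ring

/-! ### Taylor coefficients and transport by a flow -/

/-- The Taylor coefficients of a function at a point. -/
noncomputable def taylorCoef (f : ℝ → ℝ) (x : ℝ) (k : ℕ) : ℝ := iteratedDeriv k f x / k !

theorem taylorCoef_deriv (f : ℝ → ℝ) (x : ℝ) (k : ℕ) :
    taylorCoef (deriv f) x k = (k + 1) * taylorCoef f x (k + 1) := by
  rw [taylorCoef, taylorCoef, ← iteratedDeriv_succ', Nat.factorial_succ]
  push_cast
  field_simp

theorem taylorCoef_mul {f g : ℝ → ℝ} (hf : ContDiff ℝ ∞ f) (hg : ContDiff ℝ ∞ g) (x : ℝ) (k : ℕ) :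
    taylorCoef (fun x => f x * g x) x k
      = ∑ p ∈ Finset.HasAntidiagonal.antidiagonal k, taylorCoef f x p.1 * taylorCoef g x p.2 := by
  have h := iteratedDeriv_mul (n := k) (f := f) (g := g) (x := x)
    (hf.contDiffAt.of_le (by exact_mod_cast le_top)) (hg.contDiffAt.of_le (by exact_mod_cast le_top))
  have h' : iteratedDeriv k (fun x => f x * g x) x = _ := h
  rw [taylorCoef, h', Finset.Nat.sum_antidiagonal_eq_sum_range_succ
    (fun i j => taylorCoef f x i * taylorCoef g x j), Finset.sum_div]
  refine Finset.sum_congr rfl fun i hi => ?_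
  have hik : i ≤ k := Nat.lt_succ_iff.1 (Finset.mem_range.1 hi)
  rw [taylorCoef, taylorCoef, Nat.cast_choose ℝ hik]
  field_simp

/-- If `X' = y ^ 2` and `w' ∘ X = q / y`, then bounds on the Taylor coefficients of `y` and `q`
yield bounds on the derivatives of `w'`. -/
theorem abs_iteratedDeriv_deriv_le_of_transport {w X y q : ℝ → ℝ} (hw : ContDiff ℝ ∞ w)
    (hy : ContDiff ℝ ∞ y) (hq : ContDiff ℝ ∞ q) (hy0 : ∀ x, y x ≠ 0)
    (hX : ∀ x, HasDerivAt X (y x ^ 2) x) (hwX : ∀ x, deriv w (X x) = q x / y x)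
    {Q : ℕ → ℝ} (hQ : IsSupermul Q) {D H x : ℝ} (hD : 0 < D) (hH : |(y x)⁻¹| ≤ H)
    (hyQ : ∀ k, |taylorCoef y x k| ≤ D * Q k) (hqQ : ∀ k, |taylorCoef q x k| ≤ D * Q k) (k : ℕ) :
    |iteratedDeriv k (deriv w) (X x)| ≤ D * H * (k ! * ((4 * H ^ 2 * (1 + D * H)) ^ k * Q k)) := by
  have hH0 : 0 < H := (abs_pos.2 (inv_ne_zero (hy0 x))).trans_le hH
  set h : ℝ → ℝ := fun x => (y x)⁻¹ with hh
  have hhs : ContDiff ℝ ∞ h := hy.inv hy0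
  set g : ℝ → ℝ := fun x => h x * h x with hg
  have hgs : ContDiff ℝ ∞ g := hhs.mul hhs
  -- Since dX = y² dx, differentiation in X is the derivation g d/dx with g = y⁻². Hence F k is the
  -- k-th derivative of w' pulled back by X.
  let F : ℕ → ℝ → ℝ := fun k => Nat.rec (fun x => q x * h x) (fun _ f x => g x * deriv f x) k
  have hFsucc : ∀ k, F (k + 1) = fun x => g x * deriv (F k) x := fun k => rfl
  have hFs : ∀ k, ContDiff ℝ ∞ (F k) := by
    intro k
    induction k with
    | zero => exact hq.mul hhs
    | succ k ih => rw [hFsucc]; exact hgs.mul (contDiff_infty_iff_deriv.1 ih).2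
  have hwd : ContDiff ℝ ∞ (deriv w) := (contDiff_infty_iff_deriv.1 hw).2
  have hwF : ∀ k x, iteratedDeriv k (deriv w) (X x) = F k x := by
    intro k
    induction k with
    | zero => intro x; simp [F, hwX, h, div_eq_mul_inv]
    | succ k ih =>
      intro x
      have h1 : HasDerivAt (iteratedDeriv k (deriv w)) (iteratedDeriv (k + 1) (deriv w) (X x))
          (X x) := by
        rw [iteratedDeriv_succ]
        exact ((hwd.differentiable_iteratedDeriv k (by exact_mod_cast WithTop.coe_lt_top _))
          (X x)).hasDerivAt
      have h2 := h1.comp x (hX x)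
      have h3 : iteratedDeriv k (deriv w) ∘ X = F k := funext ih
      rw [h3] at h2
      rw [hFsucc]
      simp only [h2.deriv]
      have := hy0 x
      simp only [hg, hh]
      field_simp
  set Q₁ : ℕ → ℝ := fun k => (1 + D * H) ^ k * Q k
  have hQ₁ : IsSupermul Q₁ := hQ.pow_mul (by positivity)
  have hQQ₁ : ∀ k, Q k ≤ Q₁ k := fun k =>
    le_mul_of_one_le_left (hQ.nonneg k) (one_le_pow₀ (by nlinarith [mul_pos hD hH0]))
  have hhQ : ∀ k, |taylorCoef h x k| ≤ H * Q₁ k := by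
    refine hQ.inv_le (y := taylorCoef y x) hD hyQ (by simpa [taylorCoef, hh] using hH) ?_ ?_
    · simp [taylorCoef, hh, hy0 x]
    · intro k
      rw [← taylorCoef_mul hy hhs]
      have : (fun x => y x * h x) = fun _ => (1 : ℝ) := by
        ext x; simp [hh, hy0 x]
      rw [this]
      simp [taylorCoef, iteratedDeriv_const]
  have hgQ : ∀ k, |taylorCoef g x k| ≤ H * H * (2 ^ k * Q₁ k) := fun k => by
    rw [taylorCoef_mul hhs hhs]
    exact hQ₁.conv_le hH0.le hhQ hhQ k
  have hF0 : ∀ k, |taylorCoef (F 0) x k| ≤ D * H * (2 ^ k * Q₁ k) := fun k => by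
    have : F 0 = fun x => q x * h x := rfl
    rw [this, taylorCoef_mul hq hhs]
    exact hQ₁.conv_le hD.le (fun k => (hqQ k).trans (by have := hQQ₁ k; gcongr)) hhQ k
  have hmain := (hQ₁.pow_mul (zero_le_two)).derivation_le (g := taylorCoef g x)
    (F := fun k => taylorCoef (F k) x) (by positivity) (by positivity) hgQ hF0 (by
      intro k j
      rw [hFsucc, taylorCoef_mul hgs (contDiff_infty_iff_deriv.1 (hFs k)).2]
      simp only [taylorCoef_deriv]) k 0
  have hc : ((∏ i ∈ Finset.range k, (2 * i + 1) : ℕ) : ℝ) ≤ 2 ^ k * k ! := by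
    exact_mod_cast prod_odd_le k
  rw [hwF]
  have e : |F k x| = |taylorCoef (F k) x 0| := by simp [taylorCoef]
  rw [e]
  refine hmain.trans ?_
  simp only [zero_add, Nat.choose_self, Nat.cast_one, mul_one]
  have := hQ₁.nonneg k
  -- In 4 = 2 · 2, one factor comes from (2k-1)!! ≤ 2^k k! and one from the products g = h · h and q
  -- · h.
  calc _ ≤ D * H * (H * H) ^ k * (2 ^ k * k !) * (2 ^ k * Q₁ k) := by gcongr
    _ = _ := by
      simp only [Q₁, show (4 : ℝ) = 2 * 2 by norm_num, mul_pow]; ring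

/-! ### Periodic functions, weight sequences and their supermultiplicative majorants -/

theorem exists_forall_le_mul_of_eventually {a b : ℕ → ℝ} (hb : ∀ k, 0 < b k)
    (h : ∀ᶠ k in atTop, a k ≤ b k) : ∃ A : ℝ, 1 ≤ A ∧ ∀ k, a k ≤ A * b k := by
  obtain ⟨N, hN⟩ := eventually_atTop.1 h
  have hnn : ∀ k, 0 ≤ |a k| / b k := fun k => div_nonneg (abs_nonneg _) (hb k).le
  refine ⟨1 + ∑ i ∈ Finset.range N, |a i| / b i, ?_, fun k => ?_⟩
  · linarith [Finset.sum_nonneg fun i (_ : i ∈ Finset.range N) => hnn i]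
  rcases le_or_gt N k with hk | hk
  · refine (hN k hk).trans (le_mul_of_one_le_left (hb k).le ?_)
    linarith [Finset.sum_nonneg fun i (_ : i ∈ Finset.range N) => hnn i]
  · have h1 : |a k| / b k ≤ ∑ i ∈ Finset.range N, |a i| / b i :=
      Finset.single_le_sum (f := fun i => |a i| / b i) (fun i _ => hnn i) (Finset.mem_range.2 hk)
    rw [← div_le_iff₀ (hb k)]
    have : a k / b k ≤ |a k| / b k := div_le_div_of_nonneg_right (le_abs_self _) (hb k).le
    linarith

theorem Function.Periodic.exists_abs_le {f : ℝ → ℝ} {T : ℝ} (hf : Function.Periodic f T) (hT : 0 < T)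
    (hc : Continuous f) : ∃ B : ℝ, 0 < B ∧ ∀ x, |f x| ≤ B := by
  obtain ⟨C, hC⟩ := isCompact_Icc.exists_bound_of_continuousOn (s := Icc 0 T) hc.continuousOn
  refine ⟨max C 1, by positivity, fun x => ?_⟩
  obtain ⟨z, hz, hzx⟩ := hf.exists_mem_Ico₀ hT x
  rw [hzx]
  exact (hC z ⟨hz.1, hz.2.le⟩).trans (le_max_left _ _)

theorem Function.Periodic.deriv {f : ℝ → ℝ} {T : ℝ} (hf : Function.Periodic f T) :
    Function.Periodic (deriv f) T := fun x => by
  rw [← deriv_comp_add_const, show (fun x => f (x + T)) = f from funext hf]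

theorem Function.Periodic.iteratedDeriv {f : ℝ → ℝ} {T : ℝ} (hf : Function.Periodic f T) (k : ℕ) :
    Function.Periodic (iteratedDeriv k f) T := by
  induction k with
  | zero => simpa using hf
  | succ k ih => rw [iteratedDeriv_succ]; exact ih.deriv

namespace IsWeightSequence

variable {M : ℕ → ℝ}

/-- Log-convexity says that the quotients M_{k+1}/M_k increase; this is that monotonicity with
denominators cleared. -/
theorem ratio_le (hM : IsWeightSequence M) (i j : ℕ) :
    M (i + 1) * M (i + j) ≤ M i * M (i + j + 1) := by
  induction j with
  | zero => simp [mul_comm]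
  | succ j ih =>
    have h1 := hM.log_convex (i + j)
    have p0 := hM.pos (i + j)
    have p1 := hM.pos (i + j + 1)
    have p2 := hM.pos (i + 1)
    have p3 := hM.pos i
    refine le_of_mul_le_mul_right ?_ p0
    rw [← add_assoc]
    calc M (i + 1) * M (i + j + 1) * M (i + j) = M (i + 1) * M (i + j) * M (i + j + 1) := by ring
      _ ≤ M i * M (i + j + 1) * M (i + j + 1) := by gcongr
      _ = M i * M (i + j + 1) ^ 2 := by ring
      _ ≤ M i * (M (i + j) * M (i + j + 2)) := by gcongr
      _ = _ := by ring_nf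

theorem mul_le (hM : IsWeightSequence M) (i j : ℕ) : M i * M j ≤ M 0 * M (i + j) := by
  induction i with
  | zero => simp
  | succ i ih =>
    refine le_of_mul_le_mul_right ?_ (hM.pos i)
    have := hM.pos (i + 1)
    have := hM.pos 0
    calc M (i + 1) * M j * M i = M (i + 1) * (M i * M j) := by ring
      _ ≤ M (i + 1) * (M 0 * M (i + j)) := by gcongr
      _ = M 0 * (M (i + 1) * M (i + j)) := by ring
      _ ≤ M 0 * (M i * M (i + j + 1)) := by gcongr 1; exact hM.ratio_le i j
      _ = _ := by ring_nf

theorem isSupermul (hM : IsWeightSequence M) : IsSupermul fun k => M k / M 0 where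
  zero := div_self (hM.pos 0).ne'
  nonneg k := (div_pos (hM.pos k) (hM.pos 0)).le
  mul_le i j := by
    have h0 := hM.pos 0
    rw [div_mul_div_comm, div_le_div_iff₀ (by positivity) h0]
    nlinarith [hM.mul_le i j]

theorem succ_le (hM : IsWeightSequence M) : ∃ L : ℝ, 0 < L ∧ ∀ k, M (k + 1) ≤ L * (L ^ k * M k) := by
  obtain ⟨C, hC⟩ := hM.moderate_growth
  have p1 := hM.pos 1
  have p0 := hM.pos 0
  -- The entry M 1 / M 0 serves k = 0, which moderate growth, stated for positive indices only, does
  -- not reach.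
  refine ⟨max (max C 1) (max (M 1 * max C 1) (M 1 / M 0)), by positivity, fun k => ?_⟩
  set L := max (max C 1) (max (M 1 * max C 1) (M 1 / M 0))
  have hL : 0 ≤ L := by positivity
  rcases Nat.eq_zero_or_pos k with rfl | hk
  · have : M 1 / M 0 ≤ L := (le_max_right _ _).trans (le_max_right _ _)
    rw [div_le_iff₀ p0] at this
    simpa using this
  have pk := hM.pos k
  have h := hC k 1 hk one_pos
  have hq : 0 < M (k + 1) / (M k * M 1) := div_pos (hM.pos _) (by positivity)
  have h1 : M (k + 1) / (M k * M 1) ≤ max C 1 ^ (k + 1) := by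
    have h2 := Real.rpow_le_rpow (by positivity) (h.trans (le_max_left C 1))
      (by positivity : (0 : ℝ) ≤ ((k + 1 : ℕ) : ℝ))
    rw [← Real.rpow_mul hq.le, Real.rpow_natCast] at h2
    have e : 1 / ((k : ℝ) + ((1 : ℕ) : ℝ)) * ((k + 1 : ℕ) : ℝ) = 1 := by push_cast; field_simp
    rwa [e, Real.rpow_one] at h2
  rw [div_le_iff₀ (by positivity)] at h1
  calc M (k + 1) ≤ max C 1 ^ (k + 1) * (M k * M 1) := h1
    _ = (M 1 * max C 1) * (max C 1 ^ k * M k) := by ring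
    _ ≤ _ := by
      gcongr
      · exact (le_max_left _ _).trans (le_max_right _ _)
      · exact le_max_left _ _

/-- A geometric-type majorant that is supermultiplicative. -/
theorem exists_isSupermul_ge (hM : IsWeightSequence M) {b : ℕ → ℝ} {C ρ : ℝ} (hρ : 0 < ρ)
    (hb : ∀ k, b k ≤ C * (ρ ^ k * M k)) :
    ∃ Q, IsSupermul Q ∧ (∀ k, 0 < k → b k ≤ Q k) ∧
      ∃ σ : ℝ, 0 < σ ∧ ∃ A : ℝ, 0 < A ∧ ∀ k, Q k ≤ A * (σ ^ k * M k) := by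
  have h0 := hM.pos 0
  -- For k ≥ 1 the constant C M_0 is swallowed by B^k. At k = 0 this is impossible since Q 0 = 1,
  -- which is why only positive k are claimed.
  set B := max (C * M 0) 1
  have hB1 : 1 ≤ B := le_max_right _ _
  refine ⟨_, hM.isSupermul.pow_mul (by positivity : 0 ≤ B * ρ), fun k hk => ?_, B * ρ,
    by positivity, 1 / M 0, by positivity, fun k => le_of_eq (by ring)⟩
  have hk := hM.pos k
  calc b k ≤ C * (ρ ^ k * M k) := hb k
    _ = C * M 0 * (ρ ^ k * (M k / M 0)) := by field_simp
    _ ≤ B ^ k * (ρ ^ k * (M k / M 0)) := by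
        gcongr
        exact (le_max_left _ _).trans (le_self_pow₀ hB1 (by omega))
    _ = _ := by ring

/-- In the Beurling case a sequence is dominated by supermultiplicative sequences of
arbitrarily small geometric rate relative to `M`. -/
theorem exists_isSupermul_ge_of_tendsto (hM : IsWeightSequence M)
    (hM' : Tendsto (fun k : ℕ => M k ^ (1 / (k : ℝ))) atTop atTop) {b : ℕ → ℝ}
    (hb : ∀ ρ : ℝ, 0 < ρ → ∃ C : ℝ, ∀ k, b k ≤ C * (ρ ^ k * M k)) {ε : ℝ} (hε : 0 < ε) :
    ∃ Q, IsSupermul Q ∧ (∀ k, 0 < k → b k ≤ Q k) ∧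
      ∃ A : ℝ, 0 < A ∧ ∀ k, Q k ≤ A * (ε ^ k * M k) := by
  have h0 := hM.pos 0
  set m : ℕ → ℝ := fun k => ε ^ k * (M k / M 0) with hm
  have hms : IsSupermul m := hM.isSupermul.pow_mul hε.le
  have hmpos : ∀ k, 0 < m k := fun k => by have := hM.pos k; positivity
  -- Using half the target rate leaves a factor 2^(-k), which eventually beats the constant.
  obtain ⟨C, hC⟩ := hb (ε / 2) (by positivity)
  have hlarge : ∀ᶠ k : ℕ in atTop, b k ≤ m k := by
    have h2 : Tendsto (fun k : ℕ => (2 : ℝ) ^ k) atTop atTop :=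
      tendsto_pow_atTop_atTop_of_one_lt one_lt_two
    filter_upwards [h2.eventually_ge_atTop (C * M 0)] with k hk
    have := hM.pos k
    calc b k ≤ C * ((ε / 2) ^ k * M k) := hC k
      _ = (C * M 0) * ((ε / 2) ^ k * (M k / M 0)) := by field_simp
      _ ≤ 2 ^ k * ((ε / 2) ^ k * (M k / M 0)) := by gcongr
      _ = m k := by rw [div_pow]; simp only [hm]; field_simp
  obtain ⟨J, hJ⟩ := eventually_atTop.1 hlarge
  set B : ℝ := 1 + ∑ i ∈ Finset.range J, |b i| with hBdef
  have hB1 : 1 ≤ B := by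
    linarith [Finset.sum_nonneg fun i (_ : i ∈ Finset.range J) => abs_nonneg (b i)]
  have hbB : ∀ k < J, b k ≤ B := fun k hk => by
    have := Finset.single_le_sum (f := fun i => |b i|) (fun i _ => abs_nonneg (b i))
      (Finset.mem_range.2 hk)
    linarith [le_abs_self (b k)]
  -- The rate must remain ε, so constants cannot be absorbed into it as in the Roumieu case. Instead
  -- Q is the least supermultiplicative sequence above both m and B^k: m dominates the tail of b,
  -- and B^k dominates its first terms of positive index.
  let Q : ℕ → ℝ := fun k =>
    (Finset.range (k + 1)).sup' Finset.nonempty_range_add_one fun s => B ^ s * m (k - s)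
  have hle : ∀ k s, s ≤ k → B ^ s * m (k - s) ≤ Q k := fun k s hs =>
    Finset.le_sup' (fun s => B ^ s * m (k - s)) (Finset.mem_range.2 (by omega))
  have hex : ∀ k, ∃ s ≤ k, Q k = B ^ s * m (k - s) := fun k => by
    obtain ⟨s, hs, h⟩ := Finset.exists_mem_eq_sup' (s := Finset.range (k + 1))
      Finset.nonempty_range_add_one fun s => B ^ s * m (k - s)
    exact ⟨s, Nat.lt_succ_iff.1 (Finset.mem_range.1 hs), h⟩
  refine ⟨Q, ⟨?_, fun k => ?_, fun i j => ?_⟩, fun k hk => ?_, ?_⟩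
  · simp [Q, hms.zero]
  · have h1 := hle k 0 (Nat.zero_le k)
    have h2 := hmpos k
    simp only [pow_zero, one_mul, Nat.sub_zero] at h1
    linarith
  · obtain ⟨s, hs, hQs⟩ := hex i
    obtain ⟨r, hr, hQr⟩ := hex j
    rw [hQs, hQr]
    calc B ^ s * m (i - s) * (B ^ r * m (j - r)) = B ^ (s + r) * (m (i - s) * m (j - r)) := by ring
      _ ≤ B ^ (s + r) * m (i - s + (j - r)) := by
          have := hms.mul_le (i - s) (j - r)
          gcongr
      _ = B ^ (s + r) * m (i + j - (s + r)) := by congr 2; omega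
      _ ≤ _ := hle _ _ (by omega)
  · rcases lt_or_ge k J with h | h
    · refine (hbB k h).trans ((le_self_pow₀ hB1 hk.ne').trans ?_)
      simpa [hms.zero] using hle k k le_rfl
    · refine (hJ k h).trans ?_
      simpa using hle k 0 (Nat.zero_le k)
  -- This is where M_k^(1/k) → ∞ enters: it makes any geometric sequence negligible against ε^k M_k.
  · have hBm : ∀ᶠ k : ℕ in atTop, B ^ k ≤ ε ^ k * M k := by
      filter_upwards [hM'.eventually_ge_atTop (B / ε), eventually_gt_atTop 0] with k hk hk0
      have h1 := pow_le_pow_left₀ (by positivity) hk k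
      rw [← Real.rpow_natCast (M k ^ _), ← Real.rpow_mul (hM.pos k).le, one_div,
        inv_mul_cancel₀ (by positivity), Real.rpow_one, div_pow, div_le_iff₀ (by positivity)] at h1
      linarith
    obtain ⟨A, hA1, hA⟩ := exists_forall_le_mul_of_eventually
      (fun k => by have := hM.pos k; positivity) hBm
    refine ⟨A, by positivity, fun k => ?_⟩
    obtain ⟨s, hs, hQs⟩ := hex k
    rw [hQs]
    have hmks := hmpos (k - s)
    have h3 : m s * m (k - s) ≤ m k := by simpa [hs] using hms.mul_le s (k - s)
    calc B ^ s * m (k - s) ≤ A * (ε ^ s * M s) * m (k - s) := by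
          have := hA s
          gcongr
      _ = A * M 0 * (m s * m (k - s)) := by simp only [hm]; field_simp
      _ ≤ A * M 0 * m k := by gcongr
      _ = _ := by simp only [hm]; field_simp

end IsWeightSequence

/-! ### Denjoy–Carleman classes of periodic functions under transport -/

/-- The derivatives of `f` are bounded on `ℝ` at geometric rate `ρ` relative to `k! M_k`. -/
def UniformDerivBound (M : ℕ → ℝ) (f : ℝ → ℝ) (ρ : ℝ) : Prop :=
  ∃ C : ℝ, ∀ x k, |iteratedDeriv k f x| ≤ C * (ρ ^ k * (k ! * M k))

theorem DenjoyCarlemanBounded.uniform {M : ℕ → ℝ} (hM : ∀ k, 0 < M k) {f : ℝ → ℝ} {T ρ : ℝ}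
    (hT : 0 < T) (hf : Function.Periodic f T) (hρ : 0 < ρ)
    (h : DenjoyCarlemanBounded M f (Icc 0 T) ρ) : UniformDerivBound M f ρ := by
  obtain ⟨C, hC⟩ := h
  refine ⟨C, fun x k => ?_⟩
  obtain ⟨z, hz, hzx⟩ := (hf.iteratedDeriv k).exists_mem_Ico₀ hT x
  rw [hzx]
  have := hM k
  have h1 := hC z ⟨hz.1, hz.2.le⟩ k
  rw [div_le_iff₀ (by positivity)] at h1
  linarith

theorem UniformDerivBound.denjoyCarlemanBounded {M : ℕ → ℝ} (hM : ∀ k, 0 < M k) {f : ℝ → ℝ} {ρ : ℝ}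
    (hρ : 0 < ρ) (h : UniformDerivBound M f ρ) (K : Set ℝ) : DenjoyCarlemanBounded M f K ρ := by
  obtain ⟨C, hC⟩ := h
  refine ⟨C, fun x _ k => ?_⟩
  have := hM k
  rw [div_le_iff₀ (by positivity)]
  linarith [hC x k]

theorem isRoumieu_iff {M : ℕ → ℝ} (hM : ∀ k, 0 < M k) {f : ℝ → ℝ} {T : ℝ} (hT : 0 < T)
    (hf : Function.Periodic f T) :
    IsRoumieu M f ↔ ContDiff ℝ ∞ f ∧ ∃ ρ : ℝ, 0 < ρ ∧ UniformDerivBound M f ρ := by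
  refine and_congr_right fun _ => ⟨fun h => ?_, fun ⟨ρ, hρ, h⟩ K _ =>
    ⟨ρ, hρ, h.denjoyCarlemanBounded hM hρ K⟩⟩
  obtain ⟨ρ, hρ, h⟩ := h _ (isCompact_Icc (a := 0) (b := T))
  exact ⟨ρ, hρ, h.uniform hM hT hf hρ⟩

theorem isBeurling_iff {M : ℕ → ℝ} (hM : ∀ k, 0 < M k) {f : ℝ → ℝ} {T : ℝ} (hT : 0 < T)
    (hf : Function.Periodic f T) :
    IsBeurling M f ↔ ContDiff ℝ ∞ f ∧ ∀ ρ : ℝ, 0 < ρ → UniformDerivBound M f ρ := by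
  refine and_congr_right fun _ => ⟨fun h ρ hρ => ?_, fun h K _ ρ hρ =>
    (h ρ hρ).denjoyCarlemanBounded hM hρ K⟩
  exact (h _ (isCompact_Icc (a := 0) (b := T)) ρ hρ).uniform hM hT hf hρ

/-- Moderate growth, through `succ_le`, pays for one derivative. The factor L is the same for all f
and ρ, so in the Beurling case every rate can still be reached. -/
theorem UniformDerivBound.taylorCoef_deriv_le {M : ℕ → ℝ} (hM : IsWeightSequence M) :
    ∃ L : ℝ, 0 < L ∧ ∀ (f : ℝ → ℝ) (ρ : ℝ), 0 < ρ → UniformDerivBound M f ρ →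
      ∃ C : ℝ, ∀ x k, |taylorCoef (deriv f) x k| ≤ C * ((L * ρ) ^ k * M k) := by
  obtain ⟨L, hL, hML⟩ := hM.succ_le
  refine ⟨2 * L, by positivity, fun f ρ hρ ⟨C, hC⟩ => ⟨C * ρ * L, fun x k => ?_⟩⟩
  have hC0 : 0 ≤ C := by
    have := (abs_nonneg _).trans (hC 0 0)
    exact nonneg_of_mul_nonneg_left this (by have := hM.pos 0; positivity)
  have h2 : ((k : ℝ) + 1) ≤ 2 ^ k := by exact_mod_cast Nat.lt_two_pow_self
  have hk : (0 : ℝ) < k ! := by positivity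
  have hMk := hM.pos k
  rw [taylorCoef, abs_div, Nat.abs_cast, div_le_iff₀ hk, ← iteratedDeriv_succ']
  calc _ ≤ C * (ρ ^ (k + 1) * ((k + 1)! * M (k + 1))) := hC x (k + 1)
    _ = C * (ρ ^ (k + 1) * (((k : ℝ) + 1) * k ! * M (k + 1))) := by
        rw [Nat.factorial_succ]; push_cast; ring
    _ ≤ C * (ρ ^ (k + 1) * (2 ^ k * k ! * (L * (L ^ k * M k)))) := by
        have := hM.pos (k + 1)
        have := hML k
        gcongr
    _ = _ := by ring

/-- The index shift back from w' to w is harmless because M_k ≤ (M_0/M_1) M_{k+1}. A bound on w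
itself is needed because transport controls w' only. -/
theorem UniformDerivBound.of_deriv {M : ℕ → ℝ} (hM : IsWeightSequence M) {w : ℝ → ℝ} {B C ρ : ℝ}
    (hρ : 0 < ρ) (hB : ∀ x, |w x| ≤ B)
    (h : ∀ x k, |iteratedDeriv k (deriv w) x| ≤ C * (k ! * (ρ ^ k * M k))) :
    UniformDerivBound M w ρ := by
  have h0 := hM.pos 0
  have h1 := hM.pos 1
  refine ⟨max (B / M 0) (C * (M 0 / M 1) / ρ), fun x k => ?_⟩
  rcases k with _ | k
  · have : B / M 0 ≤ max (B / M 0) (C * (M 0 / M 1) / ρ) := le_max_left _ _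
    rw [div_le_iff₀ h0] at this
    simpa using (hB x).trans this
  have hk := hM.pos (k + 1)
  have hk0 := hM.pos k
  have hC : 0 ≤ C := by
    have := (abs_nonneg _).trans (h 0 0)
    exact nonneg_of_mul_nonneg_left this (by positivity)
  have hle : M k ≤ (M 0 / M 1) * M (k + 1) := by
    rw [div_mul_eq_mul_div, le_div_iff₀ h1]
    exact hM.mul_le k 1
  have hf : (k ! : ℝ) ≤ (k + 1)! := by exact_mod_cast Nat.factorial_le (Nat.le_succ k)
  rw [iteratedDeriv_succ']
  calc _ ≤ C * (k ! * (ρ ^ k * M k)) := h x k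
    _ ≤ C * ((k + 1)! * (ρ ^ k * ((M 0 / M 1) * M (k + 1)))) := by gcongr
    _ = (C * (M 0 / M 1) / ρ) * (ρ ^ (k + 1) * ((k + 1)! * M (k + 1))) := by
        field_simp
        ring
    _ ≤ _ := by
        gcongr
        exact le_max_right _ _

/-- The data produced by the flow of the Hunter–Saxton equation at a fixed time. -/
structure IsTransport (p w X : ℝ → ℝ) (α β α' β' T : ℝ) : Prop where
  pos : 0 < T
  p_smooth : ContDiff ℝ ∞ p
  p_periodic : Function.Periodic p T
  w_smooth : ContDiff ℝ ∞ w
  w_periodic : Function.Periodic w T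
  surj : Function.Surjective X
  ne_zero : ∀ x, α + β * p x ≠ 0
  hasDerivAt : ∀ x, HasDerivAt X ((α + β * p x) ^ 2) x
  deriv_eq : ∀ x, deriv w (X x) = (α' + β' * p x) / (α + β * p x)

theorem abs_taylorCoef_affine_le {p : ℝ → ℝ} {Q : ℕ → ℝ} (hQ : IsSupermul Q)
    {x P : ℝ} (hP : |p x| ≤ P) (h : ∀ k, 0 < k → |taylorCoef p x k| ≤ Q k) {α β D : ℝ}
    (hD : |α| + |β| * (P + 1) ≤ D) (k : ℕ) :
    |taylorCoef (fun x => α + β * p x) x k| ≤ D * Q k := by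
  have hP0 := (abs_nonneg _).trans hP
  have hα := abs_nonneg α
  have hβ := abs_nonneg β
  rcases Nat.eq_zero_or_pos k with rfl | hk
  · simp only [taylorCoef, iteratedDeriv_zero, Nat.factorial_zero, Nat.cast_one, div_one, hQ.zero,
      mul_one]
    calc |α + β * p x| ≤ |α| + |β| * |p x| := by rw [← abs_mul]; exact abs_add_le _ _
      _ ≤ |α| + |β| * (P + 1) := by gcongr; linarith
      _ ≤ D := hD
  · have e : taylorCoef (fun x => α + β * p x) x k = β * taylorCoef p x k := by
      rw [taylorCoef, taylorCoef, iteratedDeriv_const_add hk, iteratedDeriv_const_mul_field]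
      ring
    rw [e, abs_mul]
    have := hQ.nonneg k
    have h1 := h k hk
    calc |β| * |taylorCoef p x k| ≤ |β| * Q k := by gcongr
      _ ≤ D * Q k := by gcongr; nlinarith

/-- The order of quantifiers is the point: E and S depend on the transport data alone, so the
Beurling case may choose Q afterwards, adapted to S. -/
theorem IsTransport.exists_bound {p w X : ℝ → ℝ} {α β α' β' T : ℝ}
    (h : IsTransport p w X α β α' β' T) :
    ∃ E S : ℝ, 0 < E ∧ 0 < S ∧ ∀ Q, IsSupermul Q → (∀ x k, 0 < k → |taylorCoef p x k| ≤ Q k) →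
      ∀ x k, |iteratedDeriv k (deriv w) x| ≤ E * (k ! * (S ^ k * Q k)) := by
  obtain ⟨P, hP0, hP⟩ := h.p_periodic.exists_abs_le h.pos h.p_smooth.continuous
  have hys : ∀ α β : ℝ, ContDiff ℝ ∞ fun x => α + β * p x := fun α β =>
    contDiff_const.add (contDiff_const.mul h.p_smooth)
  have hper : Function.Periodic (fun x => (α + β * p x)⁻¹) T := fun x => by
    simp only [h.p_periodic x]
  obtain ⟨H, hH0, hH⟩ := hper.exists_abs_le h.pos ((hys α β).continuous.inv₀ h.ne_zero)
  set D := 1 + (|α| + |β| * (P + 1)) + (|α'| + |β'| * (P + 1)) with hD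
  have a1 : 0 ≤ |α| + |β| * (P + 1) := by positivity
  have a2 : 0 ≤ |α'| + |β'| * (P + 1) := by positivity
  have hD0 : 0 < D := by positivity
  refine ⟨D * H, 4 * H ^ 2 * (1 + D * H), by positivity, by positivity, fun Q hQ hpQ x k => ?_⟩
  obtain ⟨z, rfl⟩ := h.surj x
  exact abs_iteratedDeriv_deriv_le_of_transport h.w_smooth (hys α β) (hys α' β') h.ne_zero
    h.hasDerivAt h.deriv_eq hQ hD0 (hH z)
    (abs_taylorCoef_affine_le hQ (hP z) (hpQ z) (by linarith))
    (abs_taylorCoef_affine_le hQ (hP z) (hpQ z) (by linarith)) k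

theorem IsTransport.isRoumieu {M : ℕ → ℝ} (hM : IsWeightSequence M) {f w X : ℝ → ℝ}
    {α β α' β' T : ℝ} (h : IsTransport (deriv f) w X α β α' β' T) (hper : Function.Periodic f T)
    (hf : IsRoumieu M f) : IsRoumieu M w := by
  rw [isRoumieu_iff hM.pos h.pos hper] at hf
  rw [isRoumieu_iff hM.pos h.pos h.w_periodic]
  obtain ⟨-, ρ, hρ, hfρ⟩ := hf
  obtain ⟨L, hL, hLf⟩ := UniformDerivBound.taylorCoef_deriv_le hM
  obtain ⟨C, hC⟩ := hLf f ρ hρ hfρ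
  obtain ⟨Q, hQ, hQC, σ, hσ, A, hA, hQA⟩ := hM.exists_isSupermul_ge
    (b := fun k => C * ((L * ρ) ^ k * M k)) (by positivity) fun k => le_rfl
  obtain ⟨E, S, hE, hS, hES⟩ := h.exists_bound
  obtain ⟨B, -, hB⟩ := h.w_periodic.exists_abs_le h.pos h.w_smooth.continuous
  refine ⟨h.w_smooth, S * σ, by positivity,
    UniformDerivBound.of_deriv hM (C := E * A) (by positivity) hB fun x k => ?_⟩
  calc _ ≤ E * (k ! * (S ^ k * Q k)) :=
        hES Q hQ (fun x k hk => (hC x k).trans (hQC k hk)) x k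
    _ ≤ E * (k ! * (S ^ k * (A * (σ ^ k * M k)))) := by
        have := hQA k
        gcongr
    _ = _ := by ring

theorem IsTransport.isBeurling {M : ℕ → ℝ} (hM : IsWeightSequence M)
    (hM' : Tendsto (fun k : ℕ => M k ^ (1 / (k : ℝ))) atTop atTop) {f w X : ℝ → ℝ}
    {α β α' β' T : ℝ} (h : IsTransport (deriv f) w X α β α' β' T) (hper : Function.Periodic f T)
    (hf : IsBeurling M f) : IsBeurling M w := by
  rw [isBeurling_iff hM.pos h.pos hper] at hf
  rw [isBeurling_iff hM.pos h.pos h.w_periodic]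
  obtain ⟨E, S, hE, hS, hES⟩ := h.exists_bound
  obtain ⟨B, -, hB⟩ := h.w_periodic.exists_abs_le h.pos h.w_smooth.continuous
  obtain ⟨L, hL, hLf⟩ := UniformDerivBound.taylorCoef_deriv_le hM
  have hbdd : ∀ k, BddAbove (range fun x => |taylorCoef (deriv f) x k|) := fun k => by
    obtain ⟨C, hC⟩ := hLf f 1 one_pos (hf.2 1 one_pos)
    exact ⟨_, forall_mem_range.2 fun x => hC x k⟩
  refine ⟨h.w_smooth, fun ρ hρ => ?_⟩
  -- The supremum over x gives one sequence valid at all base points. The rate ρ/S offsets the loss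
  -- S^k of the transport.
  obtain ⟨Q, hQ, hQb, A, hA, hQA⟩ := hM.exists_isSupermul_ge_of_tendsto hM'
    (b := fun k => ⨆ x, |taylorCoef (deriv f) x k|) (fun r hr => by
      obtain ⟨C, hC⟩ := hLf f (r / L) (by positivity) (hf.2 _ (by positivity))
      refine ⟨C, fun k => ciSup_le fun x => ?_⟩
      simpa [mul_div_cancel₀ r hL.ne'] using hC x k) (ε := ρ / S) (by positivity)
  refine UniformDerivBound.of_deriv hM (C := E * A) hρ hB fun x k => ?_
  calc _ ≤ E * (k ! * (S ^ k * Q k)) :=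
        hES Q hQ (fun x k hk => (le_ciSup (hbdd k) x).trans (hQb k hk)) x k
    _ ≤ E * (k ! * (S ^ k * (A * ((ρ / S) ^ k * M k)))) := by
        have := hQA k
        gcongr
    _ = _ := by
        rw [div_pow]; field_simp

/-! ### Real-analytic functions as a Roumieu class, and invariance of all classes -/

/-- Local Cauchy estimates obtained by re-expanding the series at z. For 2a < r the double series of
all re-expanded terms converges, and its sum S bounds a^k times the k-th coefficient, uniformly for
|z - x| ≤ a. -/
theorem HasFPowerSeriesOnBall.exists_iteratedDeriv_le {f : ℝ → ℝ}
    {p : FormalMultilinearSeries ℝ ℝ ℝ} {x : ℝ} {r : ENNReal} (hf : HasFPowerSeriesOnBall f p x r) :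
    ∃ a : NNReal, 0 < a ∧ ∃ S : NNReal, ∀ z, ‖z - x‖₊ ≤ a → ∀ k,
      ‖iteratedDeriv k f z‖ ≤ k ! * (S * (a⁻¹ : ℝ) ^ k) := by
  obtain ⟨b, hb0, hb⟩ := ENNReal.lt_iff_exists_nnreal_btwn.1 hf.r_pos
  have hb0' : 0 < b := by exact_mod_cast hb0
  set a := b / 2 with ha
  have ha0 : 0 < a := by positivity
  have haa : (a + a : ENNReal) < r := by
    have : a + a = b := by rw [ha]; exact add_halves b
    rw [← this] at hb
    simpa using hb
  have har : (a : ENNReal) < r := lt_of_le_of_lt le_self_add haa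
  have hsum := p.changeOriginSeries_summable_aux₁ (haa.trans_le hf.r_le)
  set S := ∑' k, ∑' s : Σ l : ℕ, { s : Finset (Fin (k + l)) // s.card = l },
      ‖p (k + s.1)‖₊ * a ^ s.1 * a ^ k
  refine ⟨a, ha0, S, fun z hz k => ?_⟩
  have hzr : (‖z - x‖₊ : ENNReal) < r := lt_of_le_of_lt (by exact_mod_cast hz) har
  have hz' := hf.changeOrigin hzr
  rw [add_sub_cancel] at hz'
  have h1 := hz'.factorial_smul (1 : ℝ) k
  rw [← iteratedDeriv_eq_iteratedFDeriv] at h1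
  have h2 : ‖p.changeOrigin (z - x) k fun _ => 1‖ ≤ ‖p.changeOrigin (z - x) k‖ := by
    have := (p.changeOrigin (z - x) k).le_opNorm fun _ => (1 : ℝ)
    simp only [norm_one, Finset.prod_const_one, mul_one] at this
    exact this
  have h3 : ‖p.changeOrigin (z - x) k‖₊ * a ^ k ≤ S := by
    obtain ⟨hs1, hs2⟩ := NNReal.summable_sigma.1 hsum
    refine le_trans ?_ (hs2.le_tsum' k)
    refine (mul_le_mul_left (p.nnnorm_changeOrigin_le k (hzr.trans_le hf.r_le)) _).trans ?_
    rw [← NNReal.tsum_mul_right]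
    refine Summable.tsum_le_tsum (fun s => ?_) ?_ (hs1 k)
    · gcongr
    · exact (p.changeOriginSeries_summable_aux₂ (hzr.trans_le hf.r_le) k).mul_right _
  rw [← h1, nsmul_eq_mul, norm_mul, Real.norm_natCast]
  have h4 : ‖p.changeOrigin (z - x) k‖ * (a : ℝ) ^ k ≤ S := by exact_mod_cast h3
  have ha0' : (0 : ℝ) < a := ha0
  rw [← le_div_iff₀ (by positivity)] at h4
  gcongr
  refine (h2.trans h4).trans (le_of_eq ?_)
  rw [inv_pow, div_eq_mul_inv]

/-- Within distance 1/(2ρ) of x the Lagrange remainder is at most C 2^(-k), so the Taylor series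
converges to f. -/
theorem AnalyticAt.of_iteratedDeriv_le {f : ℝ → ℝ} (hf : ContDiff ℝ ∞ f) {C ρ : ℝ} (hρ : 0 < ρ)
    (h : ∀ x k, |iteratedDeriv k f x| ≤ C * (ρ ^ k * k !)) (x : ℝ) : AnalyticAt ℝ f x := by
  have hC : 0 ≤ C := by simpa using (abs_nonneg _).trans (h x 0)
  have htc : ∀ z k, |iteratedDeriv k f z / k !| ≤ C * ρ ^ k := fun z k => by
    have hk : (0 : ℝ) < k ! := by positivity
    rw [abs_div, Nat.abs_cast, div_le_iff₀ hk]
    linarith [h z k]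
  set r : NNReal := ⟨1 / (2 * ρ), by positivity⟩ with hr
  have hr' : (r : ℝ) = 1 / (2 * ρ) := rfl
  refine ⟨FormalMultilinearSeries.ofScalars ℝ (fun n => iteratedDeriv n f x / n !), r, ?_, ?_, ?_⟩
  · refine FormalMultilinearSeries.le_radius_of_bound _ C fun n => ?_
    rw [FormalMultilinearSeries.ofScalars_norm, Real.norm_eq_abs, hr']
    calc _ ≤ C * ρ ^ n * (1 / (2 * ρ)) ^ n := by gcongr; exact htc x n
      _ = C * (1 / 2) ^ n := by rw [mul_assoc, ← mul_pow]; congr 2; field_simp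
      _ ≤ C := mul_le_of_le_one_right hC (pow_le_one₀ (by norm_num) (by norm_num))
  · rw [ENNReal.coe_pos, ← NNReal.coe_pos, hr']; positivity
  · intro y hy
    have hy' : ρ * |y| ≤ 1 / 2 := by
      rw [Metric.mem_eball, edist_zero_right] at hy
      have h1 : ‖y‖₊ < r := by exact_mod_cast hy
      have h2 : |y| < 1 / (2 * ρ) := by rw [← hr']; exact_mod_cast h1
      rw [lt_div_iff₀ (by positivity)] at h2
      linarith
    have hbd : ∀ z k, |iteratedDeriv k f z / k ! * y ^ k| ≤ C * (1 / 2) ^ k := fun z k => by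
      rw [abs_mul, abs_pow]
      calc _ ≤ C * ρ ^ k * |y| ^ k := by gcongr; exact htc z k
        _ = C * (ρ * |y|) ^ k := by rw [mul_pow]; ring
        _ ≤ _ := by gcongr
    have hgeo : Tendsto (fun k : ℕ => C * (1 / 2 : ℝ) ^ k) atTop (nhds 0) := by
      simpa using (tendsto_pow_atTop_nhds_zero_of_lt_one (by norm_num : (0 : ℝ) ≤ 1 / 2)
        (by norm_num)).const_mul C
    have hsum : Summable fun k => iteratedDeriv k f x / k ! * y ^ k :=
      Summable.of_norm_bounded ((summable_geometric_two).mul_left C) fun k => hbd x k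
    have hs : HasSum (fun k => iteratedDeriv k f x / k ! * y ^ k) (f (x + y)) := by
      -- The shift makes the partial sum of n + 1 terms the Taylor polynomial of degree n.
      rw [hsum.hasSum_iff_tendsto_nat, ← tendsto_add_atTop_iff_nat 1]
      rcases eq_or_ne y 0 with rfl | hy0
      · refine tendsto_const_nhds.congr fun n => ?_
        rw [Finset.sum_range_succ']
        simp
      rw [tendsto_iff_norm_sub_tendsto_zero]
      refine squeeze_zero (fun _ => norm_nonneg _) (fun n => ?_)
        (hgeo.comp (tendsto_add_atTop_nat 1))
      have hne : x ≠ x + y := by simpa using hy0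
      obtain ⟨z, -, hz⟩ := taylor_mean_remainder_lagrange_iteratedDeriv (f := f) (n := n) hne
        (hf.of_le (by exact_mod_cast le_top)).contDiffOn
      have e : ∑ k ∈ Finset.range (n + 1), iteratedDeriv k f x / k ! * y ^ k
          = taylorWithinEval f n (uIcc x (x + y)) x (x + y) := by
        rw [taylor_within_apply]
        refine Finset.sum_congr rfl fun k _ => ?_
        rw [iteratedDerivWithin_eq_iteratedDeriv (uniqueDiffOn_uIcc hne)
          (hf.contDiffAt.of_le (by exact_mod_cast le_top)) left_mem_uIcc, add_sub_cancel_left,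
          smul_eq_mul]
        ring
      rw [e, norm_sub_rev, hz, add_sub_cancel_left, Real.norm_eq_abs, mul_div_right_comm]
      exact hbd z (n + 1)
    refine hs.congr_fun ?_
    intro k
    simp [mul_comm]

theorem isWeightSequence_one : IsWeightSequence fun _ => 1 where
  pos _ := one_pos
  log_convex _ := by norm_num
  moderate_growth := ⟨1, fun j k _ _ => by simp⟩

/-- Compactness of one period turns the local Cauchy estimates into uniform ones. The analytic case
then needs no transport argument of its own. -/
theorem forall_analyticAt_iff_isRoumieu {f : ℝ → ℝ} {T : ℝ} (hT : 0 < T)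
    (hf : Function.Periodic f T) : (∀ x, AnalyticAt ℝ f x) ↔ IsRoumieu (fun _ => 1) f := by
  constructor
  · intro h
    rw [isRoumieu_iff (fun _ => one_pos) hT hf]
    have hs : ContDiff ℝ ∞ f := contDiff_iff_contDiffAt.2 fun x => (h x).contDiffAt
    refine ⟨hs, ?_⟩
    have hc : ∃ ρ C : ℝ, 0 < ρ ∧ 0 < C ∧ ∀ x ∈ Icc 0 T, ∀ k,
        |iteratedDeriv k f x| ≤ C * (ρ ^ k * k !) := by
      refine (isCompact_Icc (a := 0) (b := T)).induction_on (p := fun s => ∃ ρ C : ℝ, 0 < ρ ∧ 0 < C ∧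
        ∀ x ∈ s, ∀ k, |iteratedDeriv k f x| ≤ C * (ρ ^ k * k !)) ?_ ?_ ?_ ?_
      · exact ⟨1, 1, one_pos, one_pos, by simp⟩
      · rintro s t hst ⟨ρ, C, hρ, hC, h⟩
        exact ⟨ρ, C, hρ, hC, fun x hx => h x (hst hx)⟩
      · rintro s t ⟨ρ, C, hρ, hC, h⟩ ⟨ρ', C', hρ', hC', h'⟩
        refine ⟨max ρ ρ', max C C', by positivity, by positivity, fun x hx k => ?_⟩
        rcases hx with hx | hx
        · refine (h x hx k).trans ?_
          gcongr <;> exact le_max_left _ _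
        · refine (h' x hx k).trans ?_
          gcongr <;> exact le_max_right _ _
      · intro x _
        obtain ⟨p, r, hp⟩ := h x
        obtain ⟨a, ha, S, hS⟩ := hp.exists_iteratedDeriv_le
        have ha' : (0 : ℝ) < a := ha
        refine ⟨Metric.closedBall x a, mem_nhdsWithin_of_mem_nhds
          (Metric.closedBall_mem_nhds x ha'), a⁻¹, S + 1, by positivity, by positivity,
          fun z hz k => ?_⟩
        have h1 : ‖z - x‖₊ ≤ a := by
          rw [← NNReal.coe_le_coe, coe_nnnorm, ← dist_eq_norm]; exact hz
        calc |iteratedDeriv k f z| ≤ k ! * (S * (a⁻¹ : ℝ) ^ k) := hS z h1 k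
          _ = S * ((a⁻¹ : ℝ) ^ k * k !) := by ring
          _ ≤ _ := by gcongr; linarith
    obtain ⟨ρ, C, hρ, hC, hb⟩ := hc
    refine ⟨ρ, hρ, C, fun x k => ?_⟩
    obtain ⟨z, hz, hzx⟩ := (hf.iteratedDeriv k).exists_mem_Ico₀ hT x
    rw [hzx, mul_one]
    exact hb z ⟨hz.1, hz.2.le⟩ k
  · intro h
    obtain ⟨hs, ρ, hρ, C, hC⟩ := (isRoumieu_iff (fun _ => one_pos) hT hf).1 h
    exact AnalyticAt.of_iteratedDeriv_le hs hρ (by simpa using hC)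

namespace RegularityClass

variable {𝓒 : RegularityClass}

theorem MemCircle.contDiff {f : ℝ → ℝ} (h : 𝓒.MemCircle f) : ContDiff ℝ ∞ f := by
  obtain ⟨hp, hf⟩ := h
  cases 𝓒 with
  | smooth => exact hf
  | analytic => exact contDiff_iff_contDiffAt.2 fun x => (hf x).contDiffAt
  | beurling M => exact hf.1
  | roumieu M => exact hf.1

theorem MemCircle.of_isTransport (h𝓒 : 𝓒.Admissible) {f w X : ℝ → ℝ} {α β α' β' : ℝ}
    (hf : 𝓒.MemCircle f) (h : IsTransport (deriv f) w X α β α' β' (2 * Real.pi)) :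
    𝓒.MemCircle w := by
  obtain ⟨hp, hf⟩ := hf
  refine ⟨h.w_periodic, ?_⟩
  cases 𝓒 with
  | smooth => exact h.w_smooth
  | analytic =>
    exact (forall_analyticAt_iff_isRoumieu h.pos h.w_periodic).2
      (h.isRoumieu isWeightSequence_one hp ((forall_analyticAt_iff_isRoumieu h.pos hp).1 hf))
  | beurling M => exact h.isBeurling h𝓒.1 h𝓒.2 hp hf
  | roumieu M => exact h.isRoumieu h𝓒 hp hf

end RegularityClass

/-! ### Partial derivatives of jointly smooth functions -/

/-- The partial derivative in the second variable. -/
noncomputable def dx (F : ℝ → ℝ → ℝ) : ℝ → ℝ → ℝ := fun t x => deriv (F t) x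

/-- The partial derivative in the first variable. -/
noncomputable def dt (F : ℝ → ℝ → ℝ) : ℝ → ℝ → ℝ := fun t x => deriv (fun s => F s x) t

/-- Joint smoothness of `F (t, x)` for `t ∈ I`, `x ∈ ℝ`. -/
def SmoothOn (I : Set ℝ) (F : ℝ → ℝ → ℝ) : Prop :=
  ContDiffOn ℝ ∞ (fun p : ℝ × ℝ => F p.1 p.2) (I ×ˢ univ)

namespace SmoothOn

variable {I : Set ℝ} {F G : ℝ → ℝ → ℝ}

theorem contDiffAt (hI : IsOpen I) (hF : SmoothOn I F) {t : ℝ} (ht : t ∈ I) (x : ℝ) :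
    ContDiffAt ℝ ∞ (fun p : ℝ × ℝ => F p.1 p.2) (t, x) :=
  ContDiffOn.contDiffAt hF ((hI.prod isOpen_univ).mem_nhds ⟨ht, mem_univ _⟩)

theorem hasFDerivAt (hI : IsOpen I) (hF : SmoothOn I F) {t : ℝ} (ht : t ∈ I) (x : ℝ) :
    HasFDerivAt (fun p : ℝ × ℝ => F p.1 p.2) (fderiv ℝ (fun p : ℝ × ℝ => F p.1 p.2) (t, x)) (t, x) :=
  ((hF.contDiffAt hI ht x).differentiableAt (by simp)).hasFDerivAt

theorem hasDerivAt_x_aux (hI : IsOpen I) (hF : SmoothOn I F) {t : ℝ} (ht : t ∈ I) (x : ℝ) :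
    HasDerivAt (F t) (fderiv ℝ (fun p : ℝ × ℝ => F p.1 p.2) (t, x) (0, 1)) x :=
  (hF.hasFDerivAt hI ht x).comp_hasDerivAt x
    ((hasDerivAt_const x t).prodMk (hasDerivAt_id' x))

theorem hasDerivAt_t_aux (hI : IsOpen I) (hF : SmoothOn I F) {t : ℝ} (ht : t ∈ I) (x : ℝ) :
    HasDerivAt (fun s => F s x) (fderiv ℝ (fun p : ℝ × ℝ => F p.1 p.2) (t, x) (1, 0)) t :=
  (hF.hasFDerivAt hI ht x).comp_hasDerivAt (f := fun s => (s, x)) t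
    ((hasDerivAt_id' t).prodMk (hasDerivAt_const t x))

theorem dx_eq (hI : IsOpen I) (hF : SmoothOn I F) {t : ℝ} (ht : t ∈ I) (x : ℝ) :
    dx F t x = fderiv ℝ (fun p : ℝ × ℝ => F p.1 p.2) (t, x) (0, 1) :=
  (hF.hasDerivAt_x_aux hI ht x).deriv

theorem dt_eq (hI : IsOpen I) (hF : SmoothOn I F) {t : ℝ} (ht : t ∈ I) (x : ℝ) :
    dt F t x = fderiv ℝ (fun p : ℝ × ℝ => F p.1 p.2) (t, x) (1, 0) :=
  (hF.hasDerivAt_t_aux hI ht x).deriv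

theorem hasDerivAt_x (hI : IsOpen I) (hF : SmoothOn I F) {t : ℝ} (ht : t ∈ I) (x : ℝ) :
    HasDerivAt (F t) (dx F t x) x := by
  rw [hF.dx_eq hI ht]; exact hF.hasDerivAt_x_aux hI ht x

theorem hasDerivAt_t (hI : IsOpen I) (hF : SmoothOn I F) {t : ℝ} (ht : t ∈ I) (x : ℝ) :
    HasDerivAt (fun s => F s x) (dt F t x) t := by
  rw [hF.dt_eq hI ht]; exact hF.hasDerivAt_t_aux hI ht x

/-- The chain rule along a curve `s ↦ (s, γ s)`. -/
theorem hasDerivAt_curve (hI : IsOpen I) (hF : SmoothOn I F) {γ : ℝ → ℝ} {γ' t : ℝ} (ht : t ∈ I)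
    (hγ : HasDerivAt γ γ' t) :
    HasDerivAt (fun s => F s (γ s)) (dt F t (γ t) + γ' * dx F t (γ t)) t := by
  rw [hF.dt_eq hI ht, hF.dx_eq hI ht]
  have h := (hF.hasFDerivAt hI ht (γ t)).comp_hasDerivAt t ((hasDerivAt_id' t).prodMk hγ)
  have e : ((1 : ℝ), γ') = (1, 0) + γ' • (0, 1) := by simp
  rw [e, map_add, map_smul, smul_eq_mul] at h
  exact h

theorem contDiff (hI : IsOpen I) (hF : SmoothOn I F) {t : ℝ} (ht : t ∈ I) :
    ContDiff ℝ ∞ (F t) :=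
  contDiff_iff_contDiffAt.2 fun x =>
    (hF.contDiffAt hI ht x).comp x (contDiffAt_const.prodMk contDiffAt_id)

theorem continuous (hI : IsOpen I) (hF : SmoothOn I F) {t : ℝ} (ht : t ∈ I) :
    Continuous (F t) := (hF.contDiff hI ht).continuous

theorem fderiv_apply (hI : IsOpen I) (hF : SmoothOn I F) (v : ℝ × ℝ) :
    ContDiffOn ℝ ∞ (fun p => fderiv ℝ (fun p : ℝ × ℝ => F p.1 p.2) p v) (I ×ˢ univ) :=
  (((contDiffOn_infty_iff_fderiv_of_isOpen (hI.prod isOpen_univ)).1 hF).2).clm_apply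
    contDiffOn_const

theorem dx (hI : IsOpen I) (hF : SmoothOn I F) : SmoothOn I (dx F) :=
  (hF.fderiv_apply hI (0, 1)).congr fun p hp => hF.dx_eq hI hp.1 p.2

theorem dt (hI : IsOpen I) (hF : SmoothOn I F) : SmoothOn I (dt F) :=
  (hF.fderiv_apply hI (1, 0)).congr fun p hp => hF.dt_eq hI hp.1 p.2

theorem dt_dx (hI : IsOpen I) (hF : SmoothOn I F) {t : ℝ} (ht : t ∈ I) (x : ℝ) :
    _root_.dt (_root_.dx F) t x = _root_.dx (_root_.dt F) t x := by
  set f := fun p : ℝ × ℝ => F p.1 p.2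
  have hsymm : IsSymmSndFDerivAt ℝ f (t, x) :=
    (hF.contDiffAt hI ht x).isSymmSndFDerivAt (by simp; exact ENat.LEInfty.out)
  have hd : DifferentiableAt ℝ (fderiv ℝ f) (t, x) :=
    ((((contDiffOn_infty_iff_fderiv_of_isOpen (hI.prod isOpen_univ)).1 hF).2).contDiffAt
      ((hI.prod isOpen_univ).mem_nhds ⟨ht, mem_univ _⟩)).differentiableAt (by simp)
  have h1 : ∀ v : ℝ × ℝ, HasFDerivAt (fun p => fderiv ℝ f p v)
      ((fderiv ℝ (fderiv ℝ f) (t, x)).flip v) (t, x) := fun v => by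
    have := hd.hasFDerivAt.clm_apply (hasFDerivAt_const v (t, x))
    simpa using this
  have ht' : ∀ᶠ s in nhds t, s ∈ I := hI.mem_nhds ht
  have e1 : _root_.dt (_root_.dx F) t x = fderiv ℝ (fderiv ℝ f) (t, x) (1, 0) (0, 1) := by
    have h2 : HasDerivAt (fun s => fderiv ℝ f (s, x) (0, 1)) _ t :=
      (h1 (0, 1)).comp_hasDerivAt (f := fun s => (s, x)) t ((hasDerivAt_id' t).prodMk (hasDerivAt_const t x))
    refine ((h2.congr_of_eventuallyEq ?_).deriv).trans (by simp)
    filter_upwards [ht'] with s hs using hF.dx_eq hI hs x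
  have e2 : _root_.dx (_root_.dt F) t x = fderiv ℝ (fderiv ℝ f) (t, x) (0, 1) (1, 0) := by
    have h2 : HasDerivAt (fun z => fderiv ℝ f (t, z) (1, 0)) _ x :=
      (h1 (1, 0)).comp_hasDerivAt x ((hasDerivAt_const x t).prodMk (hasDerivAt_id' x))
    refine ((h2.congr_of_eventuallyEq ?_).deriv).trans (by simp)
    exact Eventually.of_forall fun z => hF.dt_eq hI ht z
  rw [e1, e2, hsymm.eq]

theorem exists_bound (hF : SmoothOn I F) {K : Set ℝ} (hK : IsCompact K) (hKI : K ⊆ I)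
    (a b : ℝ) : ∃ C : ℝ, 0 < C ∧ ∀ t ∈ K, ∀ x ∈ Icc a b, |F t x| ≤ C := by
  obtain ⟨C, hC⟩ := (hK.prod (isCompact_Icc (a := a) (b := b))).exists_bound_of_continuousOn
    (hF.continuousOn.mono (prod_mono hKI (subset_univ _)))
  exact ⟨max C 1, by positivity, fun t ht x hx => (hC (t, x) ⟨ht, hx⟩).trans (le_max_left _ _)⟩

theorem exists_bound_of_periodic (hF : SmoothOn I F) {T : ℝ} (hT : 0 < T)
    (hper : ∀ t ∈ I, Function.Periodic (F t) T) {K : Set ℝ} (hK : IsCompact K) (hKI : K ⊆ I) :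
    ∃ C : ℝ, 0 < C ∧ ∀ t ∈ K, ∀ x, |F t x| ≤ C := by
  obtain ⟨C, hC0, hC⟩ := hF.exists_bound hK hKI 0 T
  refine ⟨C, hC0, fun t ht x => ?_⟩
  obtain ⟨z, hz, hzx⟩ := (hper t (hKI ht)).exists_mem_Ico₀ hT x
  rw [hzx]
  exact hC t ht z ⟨hz.1, hz.2.le⟩

theorem hasDerivAt_integral (hI : IsOpen I) (hF : SmoothOn I F) {t : ℝ} (ht : t ∈ I)
    {a b : ℝ} (hab : a ≤ b) :
    HasDerivAt (fun s => ∫ x in a..b, F s x) (∫ x in a..b, _root_.dt F t x) t := by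
  obtain ⟨δ, hδ, hδI⟩ := Metric.nhds_basis_closedBall.mem_iff.1 (hI.mem_nhds ht)
  obtain ⟨C, -, hC⟩ := (hF.dt hI).exists_bound (isCompact_closedBall t δ) hδI a b
  refine (intervalIntegral.hasDerivAt_integral_of_dominated_loc_of_deriv_le (bound := fun _ => C)
    (Metric.closedBall_mem_nhds t hδ) ?_ ?_ ?_ ?_ ?_ ?_).2
  · filter_upwards [hI.mem_nhds ht] with s hs
    exact (hF.continuous hI hs).aestronglyMeasurable
  · exact (hF.continuous hI ht).intervalIntegrable _ _
  · exact ((hF.dt hI).continuous hI ht).aestronglyMeasurable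
  · refine Eventually.of_forall fun x hx s hs => hC s hs x ?_
    rw [uIoc_of_le hab] at hx
    exact ⟨hx.1.le, hx.2⟩
  · exact intervalIntegrable_const
  · exact Eventually.of_forall fun x _ s hs => hF.hasDerivAt_t hI (hδI hs) x

end SmoothOn

/-! ### The integrated equation and the conserved energy -/

namespace IsPeriodicHSSolution

variable {I : Set ℝ} {u : ℝ → ℝ → ℝ}

theorem smoothOn (hu : IsPeriodicHSSolution I u) : SmoothOn I u := hu.smooth

theorem dx_periodic (hu : IsPeriodicHSSolution I u) {t : ℝ} (ht : t ∈ I) :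
    Function.Periodic (dx u t) (2 * Real.pi) := (hu.periodic t ht).deriv

theorem dt_periodic (hI : IsOpen I) (hu : IsPeriodicHSSolution I u) {t : ℝ} (ht : t ∈ I) :
    Function.Periodic (dt u t) (2 * Real.pi) := fun x => by
  refine Filter.EventuallyEq.deriv_eq ?_
  filter_upwards [hI.mem_nhds ht] with s hs using hu.periodic s hs x

theorem iteratedDeriv_two_eq (u : ℝ → ℝ → ℝ) (t : ℝ) : iteratedDeriv 2 (u t) = dx (dx u) t := by
  rw [iteratedDeriv_succ, iteratedDeriv_one]; rfl

theorem equation' (hu : IsPeriodicHSSolution I u) {t : ℝ} (ht : t ∈ I) (x : ℝ) :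
    dt (dx (dx u)) t x + 2 * dx u t x * dx (dx u) t x + u t x * dx (dx (dx u)) t x = 0 := by
  have h := hu.equation t ht x
  rw [iteratedDeriv_succ (n := 2)] at h
  simp only [iteratedDeriv_two_eq] at h
  exact h

/-- The once integrated equation, up to a constant of integration depending on time. -/
theorem integrated (hI : IsOpen I) (hu : IsPeriodicHSSolution I u) {t : ℝ} (ht : t ∈ I) (x : ℝ) :
    dt (dx u) t x + u t x * dx (dx u) t x + dx u t x ^ 2 / 2
      = dt (dx u) t 0 + u t 0 * dx (dx u) t 0 + dx u t 0 ^ 2 / 2 := by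
  have h0 := hu.smoothOn
  have h1 := h0.dx hI
  have h2 := h1.dx hI
  have h3 := h1.dt hI
  have hd : ∀ x, HasDerivAt (fun x => dt (dx u) t x + u t x * dx (dx u) t x + dx u t x ^ 2 / 2)
      0 x := fun x => by
    have e := ((h3.hasDerivAt_x hI ht x).add ((h0.hasDerivAt_x hI ht x).mul
      (h2.hasDerivAt_x hI ht x))).add (((h1.hasDerivAt_x hI ht x).pow 2).div_const 2)
    convert! e using 1
    rw [← h1.dt_dx hI ht]
    have := hu.equation' ht x
    push_cast
    linear_combination -this
  exact is_const_of_deriv_eq_zero (fun x => (hd x).differentiableAt) (fun x => (hd x).deriv) x 0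

/-- With R the integration constant, ∂ₓ(u_t + u u_x) = R + u_x²/2, and the left side integrates to
zero over a period. -/
theorem integral_dx_sq (hI : IsOpen I) (hu : IsPeriodicHSSolution I u) {t : ℝ} (ht : t ∈ I) :
    ∫ x in (0 : ℝ)..(2 * Real.pi), dx u t x ^ 2
      = -(4 * Real.pi) * (dt (dx u) t 0 + u t 0 * dx (dx u) t 0 + dx u t 0 ^ 2 / 2) := by
  set R := dt (dx u) t 0 + u t 0 * dx (dx u) t 0 + dx u t 0 ^ 2 / 2 with hR
  have h0 := hu.smoothOn
  have h1 := h0.dx hI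
  have h2 := h0.dt hI
  have hd : ∀ x, HasDerivAt (fun x => dt u t x + u t x * dx u t x) (R + dx u t x ^ 2 / 2) x :=
    fun x => by
      convert! (h2.hasDerivAt_x hI ht x).add ((h0.hasDerivAt_x hI ht x).mul
        (h1.hasDerivAt_x hI ht x)) using 1
      rw [hR, ← hu.integrated hI ht x, ← h0.dt_dx hI ht]
      ring
  have hc : Continuous fun x => dx u t x ^ 2 := (h1.continuous hI ht).pow 2
  have h := intervalIntegral.integral_eq_sub_of_hasDerivAt (a := 0) (b := 2 * Real.pi)
    (fun x _ => hd x) ((continuous_const.add (hc.div_const 2)).intervalIntegrable _ _)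
  have p1 := (hu.dt_periodic hI ht) 0
  have p2 := (hu.periodic t ht) 0
  have p3 := (hu.dx_periodic ht) 0
  rw [zero_add] at p1 p2 p3
  rw [p1, p2, p3, sub_self, intervalIntegral.integral_add intervalIntegrable_const
    ((hc.div_const 2).intervalIntegrable _ _), intervalIntegral.integral_const,
    intervalIntegral.integral_div, smul_eq_mul] at h
  linear_combination 2 * h

/-- The energy density obeys a conservation law: ∂_t(u_x²) = ∂ₓ(2Ru - u u_x²). -/
theorem integral_dx_sq_eq (hI : IsOpen I) (hIc : I.OrdConnected) (hu : IsPeriodicHSSolution I u)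
    {t s : ℝ} (ht : t ∈ I) (hs : s ∈ I) :
    ∫ x in (0 : ℝ)..(2 * Real.pi), dx u t x ^ 2 = ∫ x in (0 : ℝ)..(2 * Real.pi), dx u s x ^ 2 := by
  have h0 := hu.smoothOn
  have h1 := h0.dx hI
  have h2 := h1.dx hI
  have hsm : SmoothOn I fun t x => dx u t x ^ 2 := ContDiffOn.pow h1 2
  have key : ∀ t ∈ I, HasDerivAt (fun t => ∫ x in (0 : ℝ)..(2 * Real.pi), dx u t x ^ 2) 0 t := by
    intro t ht
    have hd := hsm.hasDerivAt_integral hI ht Real.two_pi_pos.le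
    convert! hd using 1
    set R := dt (dx u) t 0 + u t 0 * dx (dx u) t 0 + dx u t 0 ^ 2 / 2 with hR
    have hg : ∀ x, HasDerivAt (fun x => 2 * R * u t x - u t x * dx u t x ^ 2)
        (dt (fun t x => dx u t x ^ 2) t x) x := fun x => by
      have e1 : dt (fun t x => dx u t x ^ 2) t x = 2 * dx u t x * dt (dx u) t x := by
        exact ((h1.hasDerivAt_t hI ht x).pow 2).deriv.trans (by simp)
      rw [e1]
      convert! ((h0.hasDerivAt_x hI ht x).const_mul (2 * R)).sub ((h0.hasDerivAt_x hI ht x).mul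
        ((h1.hasDerivAt_x hI ht x).pow 2)) using 1
      rw [hR, ← hu.integrated hI ht x]
      simp only [Nat.cast_ofNat, Nat.add_one_sub_one, pow_one, Pi.pow_apply]
      ring
    rw [intervalIntegral.integral_eq_sub_of_hasDerivAt (fun x _ => hg x)
      (((hsm.dt hI).continuous hI ht).intervalIntegrable _ _)]
    have p2 := (hu.periodic t ht) 0
    have p3 := (hu.dx_periodic ht) 0
    rw [zero_add] at p2 p3
    rw [p2, p3, sub_self]
  exact hI.is_const_of_deriv_eq_zero hIc.isPreconnected
    (fun t ht => (key t ht).differentiableAt.differentiableWithinAt)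
    (fun t ht => (key t ht).deriv) ht hs

/-- The once integrated equation. -/
theorem riccati (hI : IsOpen I) (hIc : I.OrdConnected) (h0I : (0 : ℝ) ∈ I)
    (hu : IsPeriodicHSSolution I u) {t : ℝ} (ht : t ∈ I) (x : ℝ) :
    dt (dx u) t x + u t x * dx (dx u) t x + dx u t x ^ 2 / 2
      = -((∫ x in (0 : ℝ)..(2 * Real.pi), deriv (u 0) x ^ 2) / (4 * Real.pi)) := by
  have h := hu.integral_dx_sq_eq hI hIc ht h0I
  rw [hu.integral_dx_sq hI ht] at h
  have e : (∫ x in (0 : ℝ)..(2 * Real.pi), deriv (u 0) x ^ 2)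
    = ∫ x in (0 : ℝ)..(2 * Real.pi), dx u 0 x ^ 2 := rfl
  rw [hu.integrated hI ht x, e, ← h]
  have := Real.pi_pos
  field_simp

end IsPeriodicHSSolution

/-! ### Existence and uniqueness of characteristics -/

/-- Grönwall's inequality on the interval between `0` and `t`. -/
theorem abs_le_exp_mul_of_abs_deriv_le {f f' : ℝ → ℝ} {t C : ℝ}
    (hf : ∀ s ∈ uIcc 0 t, HasDerivAt f (f' s) s) (hC : ∀ s ∈ uIcc 0 t, |f' s| ≤ C * |f s|) :
    |f t| ≤ |f 0| * Real.exp (|t| * C) := by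
  have hmem : ∀ r ∈ Icc (0 : ℝ) 1, r * t ∈ uIcc 0 t := fun r hr => by
    rcases le_total 0 t with h | h
    · rw [uIcc_of_le h]; exact ⟨by nlinarith [hr.1], by nlinarith [hr.2]⟩
    · rw [uIcc_of_ge h]; exact ⟨by nlinarith [hr.2], by nlinarith [hr.1]⟩
  have hd : ∀ r ∈ Icc (0 : ℝ) 1, HasDerivAt (fun r => f (r * t)) (f' (r * t) * t) r := fun r hr => by
    have := (hf _ (hmem r hr)).comp (h := fun r => r * t) r ((hasDerivAt_id' r).mul_const t)
    exact this.congr_deriv (by simp)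
  have h := norm_le_gronwallBound_of_norm_deriv_right_le (f := fun r => f (r * t))
    (f' := fun r => f' (r * t) * t) (a := 0) (b := 1) (δ := |f 0|) (K := |t| * C) (ε := 0)
    (fun r hr => (hd r hr).continuousAt.continuousWithinAt)
    (fun r hr => (hd r ⟨hr.1, hr.2.le⟩).hasDerivWithinAt) (by simp)
    (fun r hr => by
      rw [Real.norm_eq_abs, Real.norm_eq_abs, abs_mul, add_zero]
      have := hC _ (hmem r ⟨hr.1, hr.2.le⟩)
      nlinarith [abs_nonneg t])
    1 ⟨zero_le_one, le_rfl⟩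
  simpa [gronwallBound_ε0] using h

/-- The formula serves twice: with f 0 = 0 it forces an identity, and with f 0 = 1 it gives
positivity. -/
theorem eq_mul_exp_of_hasDerivAt {I : Set ℝ} (hI : IsOpen I) (hIc : I.OrdConnected)
    (h0 : (0 : ℝ) ∈ I) {f m : ℝ → ℝ} (hm : ContinuousOn m I)
    (hf : ∀ t ∈ I, HasDerivAt f (m t * f t) t) {t : ℝ} (ht : t ∈ I) :
    f t = f 0 * Real.exp (∫ s in (0 : ℝ)..t, m s) := by
  have hg : ∀ t ∈ I, HasDerivAt (fun t => f t * Real.exp (-∫ s in (0 : ℝ)..t, m s)) 0 t := by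
    intro t ht
    have h1 : HasDerivAt (fun t => ∫ s in (0 : ℝ)..t, m s) (m t) t :=
      intervalIntegral.integral_hasDerivAt_right
        ((hm.mono (hIc.uIcc_subset h0 ht)).intervalIntegrable)
        (hm.stronglyMeasurableAtFilter hI t ht) (hm.continuousAt (hI.mem_nhds ht))
    convert! (hf t ht).mul h1.neg.exp using 1
    ring
  have := hI.is_const_of_deriv_eq_zero hIc.isPreconnected
    (fun t ht => (hg t ht).differentiableAt.differentiableWithinAt)
    (fun t ht => (hg t ht).deriv) ht h0
  simp only [intervalIntegral.integral_same, neg_zero, Real.exp_zero, mul_one] at this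
  rw [← this, mul_assoc, ← Real.exp_add]
  simp

theorem Set.OrdConnected.exists_Icc_subset {I : Set ℝ} (hI : IsOpen I) (hIc : I.OrdConnected)
    (h0 : (0 : ℝ) ∈ I) {t : ℝ} (ht : t ∈ I) :
    ∃ a b : ℝ, a < 0 ∧ 0 < b ∧ t ∈ Ioo a b ∧ Icc a b ⊆ I := by
  obtain ⟨δ, hδ, hδI⟩ := Metric.nhds_basis_closedBall.mem_iff.1 (hI.mem_nhds h0)
  obtain ⟨ε, hε, hεI⟩ := Metric.nhds_basis_closedBall.mem_iff.1 (hI.mem_nhds ht)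
  rw [Real.closedBall_eq_Icc] at hδI hεI
  have m1 : -δ ∈ I := hδI ⟨by linarith, by linarith⟩
  have m2 : δ ∈ I := hδI ⟨by linarith, by linarith⟩
  have m3 : t - ε ∈ I := hεI ⟨by linarith, by linarith⟩
  have m4 : t + ε ∈ I := hεI ⟨by linarith, by linarith⟩
  refine ⟨min (-δ) (t - ε), max δ (t + ε), ?_, ?_, ⟨?_, ?_⟩, hIc.out ?_ ?_⟩
  · exact (min_le_left _ _).trans_lt (by linarith)
  · exact lt_of_lt_of_le hδ (le_max_left _ _)
  · exact (min_le_right _ _).trans_lt (by linarith)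
  · exact lt_of_lt_of_le (by linarith) (le_max_right _ _)
  · rcases min_choice (-δ) (t - ε) with h | h <;> rw [h] <;> assumption
  · rcases max_choice δ (t + ε) with h | h <;> rw [h] <;> assumption

namespace IsPeriodicHSSolution

variable {I : Set ℝ} {u : ℝ → ℝ → ℝ}

theorem exists_lipschitz (hI : IsOpen I) (hu : IsPeriodicHSSolution I u) {K : Set ℝ}
    (hK : IsCompact K) (hKI : K ⊆ I) :
    ∃ C : ℝ, 0 < C ∧ ∀ t ∈ K, ∀ a b, |u t b - u t a| ≤ C * |b - a| := by
  obtain ⟨C, hC0, hC⟩ := (hu.smoothOn.dx hI).exists_bound_of_periodic Real.two_pi_pos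
    (fun t ht => hu.dx_periodic ht) hK hKI
  refine ⟨C, hC0, fun t ht a b => ?_⟩
  exact convex_univ.norm_image_sub_le_of_norm_hasDerivWithin_le
    (fun x _ => (hu.smoothOn.hasDerivAt_x hI (hKI ht) x).hasDerivWithinAt)
    (fun x _ => hC t ht x) (mem_univ a) (mem_univ b)

/-- The quadratic remainder, uniform in time, is what allows the flow to be differentiated in its
initial point. -/
theorem exists_second_order (hI : IsOpen I) (hu : IsPeriodicHSSolution I u) {K : Set ℝ}
    (hK : IsCompact K) (hKI : K ⊆ I) :
    ∃ C : ℝ, 0 < C ∧ ∀ t ∈ K, ∀ a b, |u t b - u t a - dx u t a * (b - a)| ≤ C * |b - a| ^ 2 := by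
  have h1 := hu.smoothOn.dx hI
  obtain ⟨C, hC0, hC⟩ := (h1.dx hI).exists_bound_of_periodic Real.two_pi_pos
    (fun t ht => (hu.dx_periodic ht).deriv) hK hKI
  refine ⟨C, hC0, fun t ht a b => ?_⟩
  have hlip : ∀ z, |dx u t z - dx u t a| ≤ C * |z - a| := fun z =>
    convex_univ.norm_image_sub_le_of_norm_hasDerivWithin_le
      (fun x _ => (h1.hasDerivAt_x hI (hKI ht) x).hasDerivWithinAt)
      (fun x _ => hC t ht x) (mem_univ a) (mem_univ z)
  have h := (convex_uIcc a b).norm_image_sub_le_of_norm_hasDerivWithin_le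
    (f := fun z => u t z - dx u t a * z) (f' := fun z => dx u t z - dx u t a)
    (C := C * |b - a|) (fun z _ =>
      (((hu.smoothOn.hasDerivAt_x hI (hKI ht) z).sub
        ((hasDerivAt_id' z).const_mul (dx u t a))).congr_deriv (by ring)).hasDerivWithinAt)
    (fun z hz => (hlip z).trans (by
      have := abs_sub_left_of_mem_uIcc hz
      gcongr)) left_mem_uIcc right_mem_uIcc
  rw [Real.norm_eq_abs, Real.norm_eq_abs] at h
  calc _ = |u t b - dx u t a * b - (u t a - dx u t a * a)| := by congr 1; ring
    _ ≤ _ := h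
    _ = _ := by ring

theorem eq_of_hasDerivAt (hI : IsOpen I) (hIc : I.OrdConnected) (h0 : (0 : ℝ) ∈ I)
    (hu : IsPeriodicHSSolution I u) {t : ℝ} (ht : t ∈ I) {f g : ℝ → ℝ} (hfg : f 0 = g 0)
    (hf : ∀ s ∈ uIcc 0 t, HasDerivAt f (u s (f s)) s)
    (hg : ∀ s ∈ uIcc 0 t, HasDerivAt g (u s (g s)) s) : f t = g t := by
  obtain ⟨C, hC0, hC⟩ := hu.exists_lipschitz hI isCompact_uIcc (hIc.uIcc_subset h0 ht)
  have h := abs_le_exp_mul_of_abs_deriv_le (f := fun s => f s - g s)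
    (fun s hs => (hf s hs).sub (hg s hs)) fun s hs => hC s hs (g s) (f s)
  rw [hfg, sub_self, abs_zero, zero_mul] at h
  exact sub_eq_zero.1 (abs_nonpos_iff.1 h)

/-- By periodicity u is bounded and Lipschitz in x on all of ℝ, uniformly over [a, b]. A
characteristic cannot escape, so one application of Picard–Lindelöf covers the whole interval. -/
theorem exists_solution_Icc (hI : IsOpen I) (hu : IsPeriodicHSSolution I u) {a b : ℝ} (ha : a < 0)
    (hb : 0 < b) (hab : Icc a b ⊆ I) (x : ℝ) :
    ∃ Z : ℝ → ℝ, Z 0 = x ∧ ∀ t ∈ Ioo a b, HasDerivAt Z (u t (Z t)) t := by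
  obtain ⟨C, hC0, hC⟩ := hu.exists_lipschitz hI isCompact_Icc hab
  obtain ⟨L, hL0, hL⟩ := hu.smoothOn.exists_bound_of_periodic Real.two_pi_pos hu.periodic
    isCompact_Icc hab
  lift C to NNReal using hC0.le
  lift L to NNReal using hL0.le
  have hA0 : 0 ≤ L * max (b - 0) (0 - a) := by positivity
  obtain ⟨A, hA⟩ : ∃ A : NNReal, (A : ℝ) = L * max (b - 0) (0 - a) := ⟨⟨_, hA0⟩, rfl⟩
  have hPL : IsPicardLindelof u (tmin := a) (tmax := b) ⟨0, ha.le, hb.le⟩ x A 0 L C :=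
    { lipschitzOnWith := fun t ht => LipschitzOnWith.of_dist_le_mul fun y _ z _ => by
        rw [Real.dist_eq, Real.dist_eq]; exact hC t ht z y
      continuousOn := fun y _ t ht =>
        (hu.smoothOn.hasDerivAt_t hI (hab ht) y).continuousAt.continuousWithinAt
      norm_le := fun t ht y _ => hL t ht y
      mul_max_le := by rw [hA]; simp }
  obtain ⟨Z, hZ0, hZ⟩ := hPL.exists_eq_forall_mem_Icc_hasDerivWithinAt₀
  exact ⟨Z, hZ0, fun t ht => (hZ t ⟨ht.1.le, ht.2.le⟩).hasDerivAt (Icc_mem_nhds ht.1 ht.2)⟩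

/-- The global flow of a solution. -/
theorem exists_flow (hI : IsOpen I) (hIc : I.OrdConnected) (h0 : (0 : ℝ) ∈ I)
    (hu : IsPeriodicHSSolution I u) : ∃ X : ℝ → ℝ → ℝ, (∀ x, X 0 x = x) ∧
      ∀ x, ∀ t ∈ I, HasDerivAt (fun s => X s x) (u t (X t x)) t := by
  have h : ∀ x t, t ∈ I → ∃ a b : ℝ, ∃ Z : ℝ → ℝ, a < 0 ∧ 0 < b ∧ t ∈ Ioo a b ∧ Icc a b ⊆ I ∧
      Z 0 = x ∧ ∀ t ∈ Ioo a b, HasDerivAt Z (u t (Z t)) t := fun x t ht => by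
    obtain ⟨a, b, ha, hb, htab, hab⟩ := hIc.exists_Icc_subset hI h0 ht
    obtain ⟨Z, hZ⟩ := hu.exists_solution_Icc hI ha hb hab x
    exact ⟨a, b, Z, ha, hb, htab, hab, hZ⟩
  choose! a b Z ha hb htab hab hZ0 hZ using h
  -- The flow at time t is read from the local solution chosen for that t; uniqueness makes these
  -- choices agree near t.
  refine ⟨fun t x => Z x t t, fun x => hZ0 x 0 h0, fun x t ht => ?_⟩
  have hsub : ∀ t ∈ I, ∀ s ∈ Ioo (a x t) (b x t), uIcc 0 s ⊆ Ioo (a x t) (b x t) :=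
    fun t ht s hs => ordConnected_Ioo.uIcc_subset ⟨ha x t ht, hb x t ht⟩ hs
  refine (hZ x t ht t (htab x t ht)).congr_of_eventuallyEq ?_
  filter_upwards [Ioo_mem_nhds (htab x t ht).1 (htab x t ht).2] with s hs
  have hsI : s ∈ I := hab x t ht ⟨hs.1.le, hs.2.le⟩
  exact hu.eq_of_hasDerivAt hI hIc h0 hsI ((hZ0 x s hsI).trans (hZ0 x t ht).symm)
    (fun r hr => hZ x s hsI r (hsub s hsI s (htab x s hsI) hr))
    (fun r hr => hZ x t ht r (hsub t ht s hs hr))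

end IsPeriodicHSSolution

/-! ### The explicit Jacobian and flow -/

/-- The solution `S` of `S'' = -κ S`, `S 0 = 0`, `S' 0 = 1`. -/
noncomputable def oscS (κ t : ℝ) : ℝ := if κ = 0 then t else Real.sin (√κ * t) / √κ

/-- The solution `C` of `C'' = -κ C`, `C 0 = 1`, `C' 0 = 0`. -/
noncomputable def oscC (κ t : ℝ) : ℝ := Real.cos (√κ * t)

theorem oscS_zero (κ : ℝ) : oscS κ 0 = 0 := by simp [oscS]

theorem oscC_zero (κ : ℝ) : oscC κ 0 = 1 := by simp [oscC]

theorem hasDerivAt_oscS {κ : ℝ} (hκ : 0 ≤ κ) (t : ℝ) : HasDerivAt (oscS κ) (oscC κ t) t := by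
  rcases hκ.eq_or_lt with rfl | h
  · have : oscS 0 = fun t => t := by ext t; simp [oscS]
    rw [this]
    simpa [oscC] using hasDerivAt_id' t
  · have hs := Real.sqrt_pos.2 h
    have : oscS κ = fun t => Real.sin (√κ * t) / √κ := by ext t; simp [oscS, h.ne']
    rw [this]
    refine ((((hasDerivAt_id' t).const_mul √κ).sin).div_const √κ).congr_deriv ?_
    rw [oscC]; field_simp

theorem hasDerivAt_oscC {κ : ℝ} (hκ : 0 ≤ κ) (t : ℝ) : HasDerivAt (oscC κ) (-κ * oscS κ t) t := by
  refine (((hasDerivAt_id' t).const_mul √κ).cos).congr_deriv ?_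
  rcases hκ.eq_or_lt with rfl | h
  · simp
  · have hs := Real.sqrt_pos.2 h
    simp only [oscS, h.ne', if_false]
    field_simp
    rw [Real.sq_sqrt hκ]
    ring

theorem oscC_sq_add {κ : ℝ} (hκ : 0 ≤ κ) (t : ℝ) : oscC κ t ^ 2 + κ * oscS κ t ^ 2 = 1 := by
  rcases hκ.eq_or_lt with rfl | h
  · simp [oscC]
  · simp only [oscS, oscC, h.ne', if_false, div_pow, Real.sq_sqrt hκ]
    rw [mul_div_cancel₀ _ h.ne']
    exact Real.cos_sq_add_sin_sq _

theorem contDiff_oscS (κ : ℝ) : ContDiff ℝ ∞ (oscS κ) := by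
  by_cases h : κ = 0
  · have : oscS κ = fun t => t := by ext t; simp [oscS, h]
    rw [this]; exact contDiff_id
  · have : oscS κ = fun t => Real.sin (√κ * t) / √κ := by ext t; simp [oscS, h]
    rw [this]; fun_prop

theorem contDiff_oscC (κ : ℝ) : ContDiff ℝ ∞ (oscC κ) := by
  unfold oscC; fun_prop

/-- The squared frequency attached to an initial value. -/
noncomputable def hsFreq (u₀ : ℝ → ℝ) : ℝ :=
  (∫ x in (0 : ℝ)..(2 * Real.pi), deriv u₀ x ^ 2) / (8 * Real.pi)

/-- The square root of the Jacobian of the flow. -/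
noncomputable def hsJac (u₀ : ℝ → ℝ) (t x : ℝ) : ℝ :=
  oscC (hsFreq u₀) t + oscS (hsFreq u₀) t / 2 * deriv u₀ x

/-- The time derivative of `hsJac`, times two. -/
noncomputable def hsJac' (u₀ : ℝ → ℝ) (t x : ℝ) : ℝ :=
  -2 * hsFreq u₀ * oscS (hsFreq u₀) t + oscC (hsFreq u₀) t * deriv u₀ x

theorem hsFreq_nonneg (u₀ : ℝ → ℝ) : 0 ≤ hsFreq u₀ :=
  div_nonneg (intervalIntegral.integral_nonneg Real.two_pi_pos.le fun x _ => sq_nonneg _)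
    (by have := Real.pi_pos; positivity)

theorem hasDerivAt_hsJac (u₀ : ℝ → ℝ) (t x : ℝ) :
    HasDerivAt (fun s => hsJac u₀ s x) (hsJac' u₀ t x / 2) t := by
  have hκ := hsFreq_nonneg u₀
  refine ((hasDerivAt_oscC hκ t).add (((hasDerivAt_oscS hκ t).div_const 2).mul_const
    (deriv u₀ x))).congr_deriv ?_
  rw [hsJac']; ring

theorem hasDerivAt_hsJac' (u₀ : ℝ → ℝ) (t x : ℝ) :
    HasDerivAt (fun s => hsJac' u₀ s x) (-2 * hsFreq u₀ * hsJac u₀ t x) t := by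
  have hκ := hsFreq_nonneg u₀
  refine (((hasDerivAt_oscS hκ t).const_mul (-2 * hsFreq u₀)).add
    ((hasDerivAt_oscC hκ t).mul_const (deriv u₀ x))).congr_deriv ?_
  rw [hsJac]; ring

theorem hsJac_zero (u₀ : ℝ → ℝ) (x : ℝ) : hsJac u₀ 0 x = 1 := by
  simp [hsJac, oscC_zero, oscS_zero]

theorem hsJac'_zero (u₀ : ℝ → ℝ) (x : ℝ) : hsJac' u₀ 0 x = deriv u₀ x := by
  simp [hsJac', oscC_zero, oscS_zero]

/-- The flow, up to rotation. -/
noncomputable def hsFlow (u₀ : ℝ → ℝ) (t x : ℝ) : ℝ :=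
  oscC (hsFreq u₀) t ^ 2 * x + oscC (hsFreq u₀) t * oscS (hsFreq u₀) t * (u₀ x - u₀ 0)
    + oscS (hsFreq u₀) t ^ 2 / 4 * ∫ r in (0 : ℝ)..x, deriv u₀ r ^ 2

theorem hasDerivAt_integral_deriv_sq {u₀ : ℝ → ℝ} (hu₀ : ContDiff ℝ ∞ u₀) (x : ℝ) :
    HasDerivAt (fun x => ∫ r in (0 : ℝ)..x, deriv u₀ r ^ 2) (deriv u₀ x ^ 2) x := by
  have hc : Continuous fun r => deriv u₀ r ^ 2 :=
    ((contDiff_infty_iff_deriv.1 hu₀).2.continuous).pow 2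
  exact intervalIntegral.integral_hasDerivAt_right (hc.intervalIntegrable _ _)
    (hc.stronglyMeasurableAtFilter _ _) hc.continuousAt

theorem contDiff_integral_deriv_sq {u₀ : ℝ → ℝ} (hu₀ : ContDiff ℝ ∞ u₀) :
    ContDiff ℝ ∞ fun x => ∫ r in (0 : ℝ)..x, deriv u₀ r ^ 2 := by
  rw [contDiff_infty_iff_deriv]
  refine ⟨fun x => (hasDerivAt_integral_deriv_sq hu₀ x).differentiableAt, ?_⟩
  rw [show (deriv fun x => ∫ r in (0 : ℝ)..x, deriv u₀ r ^ 2) = fun x => deriv u₀ x ^ 2 from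
    funext fun x => (hasDerivAt_integral_deriv_sq hu₀ x).deriv]
  exact (contDiff_infty_iff_deriv.1 hu₀).2.pow 2

/-- `hsFlow` is ∫₀ˣ y² with the square y = C + (S/2) u₀' expanded. -/
theorem hasDerivAt_hsFlow {u₀ : ℝ → ℝ} (hu₀ : ContDiff ℝ ∞ u₀) (t x : ℝ) :
    HasDerivAt (hsFlow u₀ t) (hsJac u₀ t x ^ 2) x := by
  have h := (hu₀.differentiable (by simp) x).hasDerivAt
  refine ((((hasDerivAt_id' x).const_mul (oscC (hsFreq u₀) t ^ 2)).add
    ((h.sub_const (u₀ 0)).const_mul (oscC (hsFreq u₀) t * oscS (hsFreq u₀) t))).add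
    ((hasDerivAt_integral_deriv_sq hu₀ x).const_mul (oscS (hsFreq u₀) t ^ 2 / 4))).congr_deriv ?_
  rw [hsJac]; ring

theorem hsFlow_apply_zero (u₀ : ℝ → ℝ) (t : ℝ) : hsFlow u₀ t 0 = 0 := by simp [hsFlow]

theorem hsFlow_zero (u₀ : ℝ → ℝ) (x : ℝ) : hsFlow u₀ 0 x = x := by
  simp [hsFlow, oscC_zero, oscS_zero]

theorem contDiff_hsFlow {u₀ : ℝ → ℝ} (hu₀ : ContDiff ℝ ∞ u₀) :
    ContDiff ℝ ∞ fun p : ℝ × ℝ => hsFlow u₀ p.1 p.2 := by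
  have hC := (contDiff_oscC (hsFreq u₀)).comp (contDiff_fst (𝕜 := ℝ) (E := ℝ) (F := ℝ))
  have hS := (contDiff_oscS (hsFreq u₀)).comp (contDiff_fst (𝕜 := ℝ) (E := ℝ) (F := ℝ))
  have h1 := hu₀.comp (contDiff_snd (𝕜 := ℝ) (E := ℝ) (F := ℝ))
  have h2 := (contDiff_integral_deriv_sq hu₀).comp (contDiff_snd (𝕜 := ℝ) (E := ℝ) (F := ℝ))
  exact (((hC.pow 2).mul contDiff_snd).add ((hC.mul hS).mul (h1.sub contDiff_const))).add
    (((hS.pow 2).div_const 4).mul h2)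

/-- Over a period the cross term drops out and the increment is 2π(C² + κS²) = 2π. Hence the flow
descends to a degree-one map of the circle. -/
theorem hsFlow_add_two_pi {u₀ : ℝ → ℝ} (hu₀ : ContDiff ℝ ∞ u₀)
    (hper : Function.Periodic u₀ (2 * Real.pi)) (t x : ℝ) :
    hsFlow u₀ t (x + 2 * Real.pi) = hsFlow u₀ t x + 2 * Real.pi := by
  have hc : Continuous fun r => deriv u₀ r ^ 2 :=
    ((contDiff_infty_iff_deriv.1 hu₀).2.continuous).pow 2
  have hp : Function.Periodic (fun r => deriv u₀ r ^ 2) (2 * Real.pi) := fun r => by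
    simp only [hper.deriv r]
  have h1 : (∫ r in (0 : ℝ)..(x + 2 * Real.pi), deriv u₀ r ^ 2)
      = (∫ r in (0 : ℝ)..x, deriv u₀ r ^ 2) + hsFreq u₀ * (8 * Real.pi) := by
    rw [← intervalIntegral.integral_add_adjacent_intervals (hc.intervalIntegrable 0 x)
      (hc.intervalIntegrable x _), hp.intervalIntegral_add_eq x 0, zero_add, hsFreq,
      div_mul_cancel₀ _ (by have := Real.pi_pos; positivity)]
  rw [hsFlow, hsFlow, h1, hper x]
  linear_combination (2 * Real.pi) * oscC_sq_add (hsFreq_nonneg u₀) t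

theorem Continuous.surjective_of_add_periodic {f : ℝ → ℝ} (hf : Continuous f) {T : ℝ} (hT : 0 < T)
    (h : ∀ x, f (x + T) = f x + T) : Function.Surjective f := fun y => by
  have hp : Function.Periodic (fun x => f x - x) T := fun x => by
    simp only [h x]; ring
  obtain ⟨B, -, hB⟩ := hp.exists_abs_le hT (hf.sub continuous_id)
  exact mem_range_of_exists_le_of_exists_ge hf
    ⟨y - B, by linarith [(abs_le.1 (hB (y - B))).2]⟩
    ⟨y + B, by linarith [(abs_le.1 (hB (y + B))).1]⟩

theorem hsFlow_surjective {u₀ : ℝ → ℝ} (hu₀ : ContDiff ℝ ∞ u₀)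
    (hper : Function.Periodic u₀ (2 * Real.pi)) (t : ℝ) : Function.Surjective (hsFlow u₀ t) :=
  Continuous.surjective_of_add_periodic
    (continuous_iff_continuousAt.2 fun x => (hasDerivAt_hsFlow hu₀ t x).continuousAt)
    Real.two_pi_pos (hsFlow_add_two_pi hu₀ hper t)

/-! ### The flow of an arbitrary solution -/

/-- A flow of `u` on the times `I`. -/
structure IsFlow (I : Set ℝ) (u X : ℝ → ℝ → ℝ) : Prop where
  zero : ∀ x, X 0 x = x
  hasDerivAt : ∀ x, ∀ t ∈ I, HasDerivAt (fun s => X s x) (u t (X t x)) t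

namespace IsFlow

variable {I : Set ℝ} {u X : ℝ → ℝ → ℝ}

theorem continuousOn_dx (hI : IsOpen I) (hu : IsPeriodicHSSolution I u) (hX : IsFlow I u X) (x : ℝ) :
    ContinuousOn (fun t => dx u t (X t x)) I := fun _ ht =>
  ((hu.smoothOn.dx hI).hasDerivAt_curve hI ht
    (hX.hasDerivAt x _ ht)).continuousAt.continuousWithinAt

/-- By the Riccati equation, vy - 2y' solves f' = -(v/2) f with zero initial value, hence vanishes.
The product form avoids dividing by y, not yet known to be nonzero. -/
theorem dx_mul_hsJac (hI : IsOpen I) (hIc : I.OrdConnected) (h0 : (0 : ℝ) ∈ I)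
    (hu : IsPeriodicHSSolution I u) (hX : IsFlow I u X) (x : ℝ) {t : ℝ} (ht : t ∈ I) :
    dx u t (X t x) * hsJac (u 0) t x = hsJac' (u 0) t x := by
  have h := eq_mul_exp_of_hasDerivAt hI hIc h0 (m := fun t => -dx u t (X t x) / 2)
    (f := fun t => dx u t (X t x) * hsJac (u 0) t x - hsJac' (u 0) t x)
    (((hX.continuousOn_dx hI hu x).neg).div_const 2) (fun t ht => by
      have h1 := (hu.smoothOn.dx hI).hasDerivAt_curve hI ht (hX.hasDerivAt x t ht)
      refine ((h1.mul (hasDerivAt_hsJac (u 0) t x)).sub (hasDerivAt_hsJac' (u 0) t x)).congr_deriv ?_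
      have h2 := hu.riccati hI hIc h0 ht (X t x)
      have h3 : (∫ x in (0 : ℝ)..(2 * Real.pi), deriv (u 0) x ^ 2) / (4 * Real.pi)
          = 2 * hsFreq (u 0) := by
        rw [hsFreq]; have := Real.pi_pos; field_simp; ring
      rw [h3] at h2
      linear_combination hsJac (u 0) t x * h2) ht
  simp only [hX.zero, hsJac_zero, hsJac'_zero] at h
  have e : dx u 0 x = deriv (u 0) x := rfl
  rw [e, mul_one, sub_self, zero_mul] at h
  exact sub_eq_zero.1 h

/-- From y' = (v/2) y and y(0) = 1, y is an exponential. This is the obstruction to long-time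
existence. -/
theorem hsJac_pos (hI : IsOpen I) (hIc : I.OrdConnected) (h0 : (0 : ℝ) ∈ I)
    (hu : IsPeriodicHSSolution I u) (hX : IsFlow I u X) (x : ℝ) {t : ℝ} (ht : t ∈ I) :
    0 < hsJac (u 0) t x := by
  rw [eq_mul_exp_of_hasDerivAt hI hIc h0 (m := fun t => dx u t (X t x) / 2)
    (f := fun t => hsJac (u 0) t x) ((hX.continuousOn_dx hI hu x).div_const 2) (fun t ht => by
      refine (hasDerivAt_hsJac (u 0) t x).congr_deriv ?_
      rw [← hX.dx_mul_hsJac hI hIc h0 hu x ht]; ring) ht, hsJac_zero, one_mul]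
  exact Real.exp_pos _

/-- The quotient (X(t,x') - X(t,x))/y² starts at x' - x, and its time derivative is y⁻² times the
second-order remainder of u. It therefore stays within O(|x' - x|²) of x' - x. -/
theorem hasDerivAt_x (hI : IsOpen I) (hIc : I.OrdConnected) (h0 : (0 : ℝ) ∈ I)
    (hu : IsPeriodicHSSolution I u) (hX : IsFlow I u X) (x : ℝ) {t : ℝ} (ht : t ∈ I) :
    HasDerivAt (X t) (hsJac (u 0) t x ^ 2) x := by
  have hsub : uIcc 0 t ⊆ I := hIc.uIcc_subset h0 ht
  obtain ⟨C₁, hC₁0, hC₁⟩ := hu.exists_lipschitz hI isCompact_uIcc hsub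
  obtain ⟨C₂, hC₂0, hC₂⟩ := hu.exists_second_order hI isCompact_uIcc hsub
  set y : ℝ → ℝ := fun s => hsJac (u 0) s x with hy
  have hypos : ∀ s ∈ uIcc 0 t, 0 < y s := fun s hs => hX.hsJac_pos hI hIc h0 hu x (hsub hs)
  have hyd : ∀ s ∈ I, HasDerivAt y (dx u s (X s x) * y s / 2) s := fun s hs => by
    simp only [hy]
    rw [hX.dx_mul_hsJac hI hIc h0 hu x hs]
    exact hasDerivAt_hsJac (u 0) s x
  obtain ⟨B, hB⟩ := (isCompact_uIcc (a := 0) (b := t)).exists_bound_of_continuousOn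
    (f := fun s => (y s ^ 2)⁻¹) (fun s hs =>
      (((hyd s (hsub hs)).continuousAt.pow 2).inv₀ (pow_ne_zero 2 (hypos s hs).ne')).continuousWithinAt)
  have hB0 : 0 ≤ B := (norm_nonneg _).trans (hB 0 left_mem_uIcc)
  set L := Real.exp (|t| * C₁) with hL
  have hlip : ∀ x', ∀ s ∈ uIcc 0 t, |X s x' - X s x| ≤ |x' - x| * L := fun x' s hs => by
    have hss : uIcc 0 s ⊆ uIcc 0 t := uIcc_subset_uIcc left_mem_uIcc hs
    have h := abs_le_exp_mul_of_abs_deriv_le (f := fun s => X s x' - X s x)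
      (fun r hr => (hX.hasDerivAt x' r (hsub (hss hr))).sub (hX.hasDerivAt x r (hsub (hss hr))))
      fun r hr => hC₁ r (hss hr) (X r x) (X r x')
    simp only [hX.zero] at h
    refine h.trans ?_
    have : |s| ≤ |t| := by simpa using abs_sub_left_of_mem_uIcc hs
    rw [hL]
    gcongr
  have hmain : ∀ x', |(X t x' - X t x) / y t ^ 2 - (x' - x)| ≤ B * (C₂ * L ^ 2) * |t| * |x' - x| ^ 2 := by
    intro x'
    have hd : ∀ s ∈ uIcc 0 t, HasDerivAt (fun s => (X s x' - X s x) / y s ^ 2)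
        ((y s ^ 2)⁻¹ * (u s (X s x') - u s (X s x) - dx u s (X s x) * (X s x' - X s x))) s := by
      intro s hs
      have hys := (hypos s hs).ne'
      refine (((hX.hasDerivAt x' s (hsub hs)).sub (hX.hasDerivAt x s (hsub hs))).div
        ((hyd s (hsub hs)).pow 2) (pow_ne_zero 2 hys)).congr_deriv ?_
      simp only [Pi.pow_apply, Pi.sub_apply]
      field_simp
      push_cast
      ring
    have h := (convex_uIcc 0 t).norm_image_sub_le_of_norm_hasDerivWithin_le
      (C := B * (C₂ * (|x' - x| * L) ^ 2)) (fun s hs => (hd s hs).hasDerivWithinAt)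
      (fun s hs => by
        rw [norm_mul]
        have e1 := hB s hs
        have e2 := hC₂ s hs (X s x) (X s x')
        have e3 := hlip x' s hs
        have e4 : C₂ * |X s x' - X s x| ^ 2 ≤ C₂ * (|x' - x| * L) ^ 2 := by gcongr
        exact mul_le_mul e1 (e2.trans e4) (norm_nonneg _) hB0) left_mem_uIcc right_mem_uIcc
    simp only [hX.zero, hy, hsJac_zero, one_pow, div_one, sub_zero, Real.norm_eq_abs] at h
    refine h.trans (le_of_eq (by ring))
  have hyt := hypos t right_mem_uIcc
  rw [hasDerivAt_iff_isLittleO]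
  refine Asymptotics.IsBigO.trans_isLittleO (g := fun x' => (x' - x) ^ 2) ?_ ?_
  · refine Asymptotics.IsBigO.of_bound (y t ^ 2 * (B * (C₂ * L ^ 2) * |t|)) ?_
    refine Eventually.of_forall fun x' => ?_
    have e : X t x' - X t x - (x' - x) • y t ^ 2
        = y t ^ 2 * ((X t x' - X t x) / y t ^ 2 - (x' - x)) := by
      rw [smul_eq_mul]; field_simp
    rw [e, norm_mul, Real.norm_eq_abs, Real.norm_eq_abs, Real.norm_eq_abs, abs_pow, abs_pow,
      abs_of_pos hyt, mul_assoc]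
    have := hmain x'
    gcongr
  · have := Asymptotics.isLittleO_pow_id (𝕜 := ℝ) (n := 2) one_lt_two
    refine (this.comp_tendsto (k := fun x' => x' - x) (l' := nhds x) ?_)
    have : Tendsto (fun x' => x' - x) (nhds x) (nhds (x - x)) :=
      (continuous_id.sub continuous_const).continuousAt
    simpa using this

theorem eq_hsFlow (hI : IsOpen I) (hIc : I.OrdConnected) (h0 : (0 : ℝ) ∈ I)
    (hu : IsPeriodicHSSolution I u) (hX : IsFlow I u X) (x : ℝ) {t : ℝ} (ht : t ∈ I) :
    X t x = X t 0 + hsFlow (u 0) t x := by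
  have hd : ∀ x, HasDerivAt (fun x => X t x - hsFlow (u 0) t x) 0 x := fun x =>
    ((hX.hasDerivAt_x hI hIc h0 hu x ht).sub
      (hasDerivAt_hsFlow (hu.smoothOn.contDiff hI h0) t x)).congr_deriv (sub_self _)
  have := is_const_of_deriv_eq_zero (fun x => (hd x).differentiableAt) (fun x => (hd x).deriv) x 0
  rw [hsFlow_apply_zero] at this
  linarith

theorem surjective (hI : IsOpen I) (hIc : I.OrdConnected) (h0 : (0 : ℝ) ∈ I)
    (hu : IsPeriodicHSSolution I u) (hX : IsFlow I u X) {t : ℝ} (ht : t ∈ I) :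
    Function.Surjective (X t) := fun y => by
  obtain ⟨x, hx⟩ := hsFlow_surjective (hu.smoothOn.contDiff hI h0) (hu.periodic 0 h0) t (y - X t 0)
  exact ⟨x, by rw [hX.eq_hsFlow hI hIc h0 hu x ht, hx]; ring⟩

theorem isTransport (hI : IsOpen I) (hIc : I.OrdConnected) (h0 : (0 : ℝ) ∈ I)
    (hu : IsPeriodicHSSolution I u) (hX : IsFlow I u X) {t : ℝ} (ht : t ∈ I) :
    IsTransport (deriv (u 0)) (u t) (X t) (oscC (hsFreq (u 0)) t) (oscS (hsFreq (u 0)) t / 2)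
      (-2 * hsFreq (u 0) * oscS (hsFreq (u 0)) t) (oscC (hsFreq (u 0)) t) (2 * Real.pi) where
  pos := Real.two_pi_pos
  p_smooth := (contDiff_infty_iff_deriv.1 (hu.smoothOn.contDiff hI h0)).2
  p_periodic := (hu.periodic 0 h0).deriv
  w_smooth := hu.smoothOn.contDiff hI ht
  w_periodic := hu.periodic t ht
  surj := hX.surjective hI hIc h0 hu ht
  ne_zero x := (hX.hsJac_pos hI hIc h0 hu x ht).ne'
  hasDerivAt x := hX.hasDerivAt_x hI hIc h0 hu x ht
  deriv_eq x := by
    have := hX.hsJac_pos hI hIc h0 hu x ht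
    exact (eq_div_iff this.ne').2 (hX.dx_mul_hsJac hI hIc h0 hu x ht)

end IsFlow

/-! ### Construction of a solution from the explicit flow -/

/-- The flow of the solution with initial value `u₀`. -/
noncomputable def hsLagrangian (u₀ : ℝ → ℝ) (t x : ℝ) : ℝ := u₀ 0 * t + hsFlow u₀ t x

/-- The solution of the Hunter–Saxton equation with initial value `u₀`. -/
noncomputable def hsSolution (u₀ : ℝ → ℝ) (t x : ℝ) : ℝ :=
  dt (hsLagrangian u₀) t (Function.invFun (hsLagrangian u₀ t) x)

section

variable {u₀ : ℝ → ℝ}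

theorem hsLagrangian_contDiff (hu₀ : ContDiff ℝ ∞ u₀) :
    ContDiff ℝ ∞ fun p : ℝ × ℝ => hsLagrangian u₀ p.1 p.2 :=
  (contDiff_const.mul contDiff_fst).add (contDiff_hsFlow hu₀)

theorem hsLagrangian_smoothOn (hu₀ : ContDiff ℝ ∞ u₀) (I : Set ℝ) :
    SmoothOn I (hsLagrangian u₀) := (hsLagrangian_contDiff hu₀).contDiffOn

theorem hasDerivAt_hsLagrangian (hu₀ : ContDiff ℝ ∞ u₀) (t x : ℝ) :
    HasDerivAt (hsLagrangian u₀ t) (hsJac u₀ t x ^ 2) x :=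
  (hasDerivAt_hsFlow hu₀ t x).const_add _

theorem hsLagrangian_add_two_pi (hu₀ : ContDiff ℝ ∞ u₀)
    (hper : Function.Periodic u₀ (2 * Real.pi)) (t x : ℝ) :
    hsLagrangian u₀ t (x + 2 * Real.pi) = hsLagrangian u₀ t x + 2 * Real.pi := by
  rw [hsLagrangian, hsFlow_add_two_pi hu₀ hper, hsLagrangian, add_assoc]

theorem hsLagrangian_surjective (hu₀ : ContDiff ℝ ∞ u₀)
    (hper : Function.Periodic u₀ (2 * Real.pi)) (t : ℝ) :
    Function.Surjective (hsLagrangian u₀ t) :=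
  Continuous.surjective_of_add_periodic
    (continuous_iff_continuousAt.2 fun x => (hasDerivAt_hsLagrangian hu₀ t x).continuousAt)
    Real.two_pi_pos (hsLagrangian_add_two_pi hu₀ hper t)

theorem hsLagrangian_injective (hu₀ : ContDiff ℝ ∞ u₀) {t : ℝ} (ht : ∀ x, 0 < hsJac u₀ t x) :
    Function.Injective (hsLagrangian u₀ t) :=
  (strictMono_of_hasDerivAt_pos (fun x => hasDerivAt_hsLagrangian hu₀ t x)
    fun x => pow_pos (ht x) 2).injective

theorem hsSolution_apply (hu₀ : ContDiff ℝ ∞ u₀) {t : ℝ} (ht : ∀ x, 0 < hsJac u₀ t x) (x : ℝ) :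
    hsSolution u₀ t (hsLagrangian u₀ t x) = dt (hsLagrangian u₀) t x := by
  rw [hsSolution, Function.leftInverse_invFun (hsLagrangian_injective hu₀ ht)]

theorem hsSolution_smoothOn (hu₀ : ContDiff ℝ ∞ u₀) (hper : Function.Periodic u₀ (2 * Real.pi))
    {I : Set ℝ} (hI : IsOpen I) (hJ : ∀ t ∈ I, ∀ x, 0 < hsJac u₀ t x) :
    SmoothOn I (hsSolution u₀) := by
  rintro ⟨t, x⟩ ⟨ht, -⟩
  obtain ⟨ξ, hξ⟩ := hsLagrangian_surjective hu₀ hper t x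
  let f : (ℝ × ℝ) × ℝ → ℝ := fun p => hsLagrangian u₀ p.1.1 p.2 - p.1.2
  have hf : ContDiff ℝ ∞ f :=
    ((hsLagrangian_contDiff hu₀).comp ((contDiff_fst.comp contDiff_fst).prodMk contDiff_snd)).sub
      (contDiff_snd.comp contDiff_fst)
  set w : (ℝ × ℝ) × ℝ := ((t, x), ξ) with hw
  have hfw : f w = 0 := by simp [f, w, hξ]
  have hne : hsJac u₀ t ξ ^ 2 ≠ 0 := (pow_pos (hJ t ht ξ) 2).ne'
  -- The partial derivative in ξ is y² ≠ 0, so the implicit function theorem makes the inverse flow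
  -- jointly smooth in (t, x).
  have hinv : (fderiv ℝ f w ∘L .inr ℝ (ℝ × ℝ) ℝ).IsInvertible := by
    refine ⟨ContinuousLinearEquiv.unitsEquivAut ℝ (Units.mk0 _ hne), ?_⟩
    ext
    have h1 := ((hf.differentiable (by simp) w).hasFDerivAt.comp_hasDerivAt (f := fun z => ((t, x), z))
      ξ ((hasDerivAt_const ξ (t, x)).prodMk (hasDerivAt_id' ξ))).deriv
    have h2 := ((hasDerivAt_hsLagrangian hu₀ t ξ).sub_const x).deriv
    have h3 : (fun z => hsLagrangian u₀ t z - x) = f ∘ fun z => ((t, x), z) := rfl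
    rw [h3, h1] at h2
    simpa using h2.symm
  have hcd := hf.contDiffAt (x := w)
  have hψ := hcd.contDiffAt_implicitFunction (by simp) hinv
  have hev := hcd.eventually_apply_implicitFunction (by simp) hinv
  set ψ := hcd.implicitFunction (by simp) hinv
  have hψ' : ∀ᶠ p : ℝ × ℝ in nhds (t, x), hsSolution u₀ p.1 p.2
      = dt (hsLagrangian u₀) p.1 (ψ p) := by
    filter_upwards [hev, (hI.prod isOpen_univ).mem_nhds (⟨ht, mem_univ x⟩ : (t, x) ∈ I ×ˢ univ)]
      with p hp hpI
    have e : hsLagrangian u₀ p.1 (ψ p) = p.2 := by rw [hfw] at hp; exact sub_eq_zero.1 hp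
    conv_lhs => rw [← e]
    exact hsSolution_apply hu₀ (hJ _ hpI.1) _
  have hL : ContDiffAt ℝ ∞ (fun p : ℝ × ℝ => dt (hsLagrangian u₀) p.1 p.2) (t, ψ (t, x)) :=
    ((hsLagrangian_smoothOn hu₀ univ).dt isOpen_univ).contDiffAt isOpen_univ (mem_univ t) _
  have hc : ContDiffAt ℝ ∞ (fun p : ℝ × ℝ => dt (hsLagrangian u₀) p.1 (ψ p)) (t, x) :=
    hL.comp (f := fun p : ℝ × ℝ => (p.1, ψ p)) (t, x) (contDiffAt_fst.prodMk hψ)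
  exact (hc.congr_of_eventuallyEq hψ').contDiffWithinAt

theorem isPeriodicHSSolution_hsSolution (hu₀ : ContDiff ℝ ∞ u₀)
    (hper : Function.Periodic u₀ (2 * Real.pi)) {I : Set ℝ} (hI : IsOpen I)
    (hJ : ∀ t ∈ I, ∀ x, 0 < hsJac u₀ t x) : IsPeriodicHSSolution I (hsSolution u₀) := by
  have h0 := hsSolution_smoothOn hu₀ hper hI hJ
  have h1 := h0.dx hI
  have h2 := h1.dx hI
  have h3 := h1.dt hI
  have hL := hsLagrangian_smoothOn hu₀ I
  set U := hsSolution u₀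
  have hdxL : dx (hsLagrangian u₀) = fun t x => hsJac u₀ t x ^ 2 :=
    funext₂ fun t x => (hasDerivAt_hsLagrangian hu₀ t x).deriv
  -- Computing X_tx in both orders gives 2yy' = u_x(t, X) y².
  have hv : ∀ t ∈ I, ∀ ξ, dx U t (hsLagrangian u₀ t ξ) = hsJac' u₀ t ξ / hsJac u₀ t ξ := by
    intro t ht ξ
    have e1 := (h0.hasDerivAt_x hI ht (hsLagrangian u₀ t ξ)).comp ξ
      (hasDerivAt_hsLagrangian hu₀ t ξ)
    have e2 : U t ∘ hsLagrangian u₀ t = dt (hsLagrangian u₀) t :=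
      funext fun z => hsSolution_apply hu₀ (hJ t ht) z
    rw [e2] at e1
    have e3 : dt (dx (hsLagrangian u₀)) t ξ = 2 * hsJac u₀ t ξ * (hsJac' u₀ t ξ / 2) := by
      rw [hdxL]
      exact ((hasDerivAt_hsJac u₀ t ξ).pow 2).deriv.trans (by simp)
    rw [hL.dt_dx hI ht, dx, e1.deriv] at e3
    have hp := (hJ t ht ξ).ne'
    rw [eq_div_iff hp]
    apply mul_right_cancel₀ hp
    linear_combination e3
  have hR : ∀ t ∈ I, ∀ x, dt (dx U) t x + U t x * dx (dx U) t x + dx U t x ^ 2 / 2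
      = -2 * hsFreq u₀ := by
    intro t ht x
    obtain ⟨ξ, rfl⟩ := hsLagrangian_surjective hu₀ hper t x
    have e1 := h1.hasDerivAt_curve hI ht (hL.hasDerivAt_t hI ht ξ)
    have hp := (hJ t ht ξ).ne'
    have e2 := (hasDerivAt_hsJac' u₀ t ξ).div (hasDerivAt_hsJac u₀ t ξ) hp
    have e3 := e1.unique (e2.congr_of_eventuallyEq (by
      filter_upwards [hI.mem_nhds ht] with s hs using hv s hs ξ))
    rw [← hsSolution_apply hu₀ (hJ t ht)] at e3
    rw [e3, hv t ht ξ]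
    field_simp
    ring
  refine ⟨h0, fun t ht x => ?_, fun t ht x => ?_⟩
  · obtain ⟨ξ, rfl⟩ := hsLagrangian_surjective hu₀ hper t x
    rw [← hsLagrangian_add_two_pi hu₀ hper]
    simp only [U, hsSolution_apply hu₀ (hJ t ht)]
    simp only [dt, hsLagrangian_add_two_pi hu₀ hper]
    rw [deriv_add_const]
  · rw [iteratedDeriv_succ (n := 2)]
    simp only [IsPeriodicHSSolution.iteratedDeriv_two_eq]
    have hd := ((h3.hasDerivAt_x hI ht x).add ((h0.hasDerivAt_x hI ht x).mul
      (h2.hasDerivAt_x hI ht x))).add (((h1.hasDerivAt_x hI ht x).pow 2).div_const 2)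
    have hz := hd.unique ((hasDerivAt_const x (-2 * hsFreq u₀)).congr_of_eventuallyEq
      (Eventually.of_forall fun z => hR t ht z))
    rw [← h1.dt_dx hI ht] at hz
    change dt (dx (dx U)) t x + 2 * dx U t x * dx (dx U) t x + U t x * dx (dx (dx U)) t x = 0
    push_cast at hz
    linear_combination hz

/-- Since `hsFlow` fixes the origin, its initial velocity is u₀ - u₀(0); the term u₀(0) t in
`hsLagrangian` restores the missing constant. -/
theorem hsSolution_zero (hu₀ : ContDiff ℝ ∞ u₀) : hsSolution u₀ 0 = u₀ := by
  ext x
  have h0 : hsLagrangian u₀ 0 x = x := by simp [hsLagrangian, hsFlow_zero]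
  have h := hsSolution_apply hu₀ (t := 0) (fun x => by rw [hsJac_zero]; exact one_pos) x
  rw [h0] at h
  rw [h]
  have hκ := hsFreq_nonneg u₀
  have hC := hasDerivAt_oscC hκ 0
  have hS := hasDerivAt_oscS hκ 0
  have hd : HasDerivAt (fun t => hsLagrangian u₀ t x) _ 0 :=
    ((hasDerivAt_id' (0 : ℝ)).const_mul (u₀ 0)).add
    ((((hC.pow 2).mul_const x).add ((hC.mul hS).mul_const (u₀ x - u₀ 0))).add
      (((hS.pow 2).div_const 4).mul_const (∫ r in (0 : ℝ)..x, deriv u₀ r ^ 2)))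
  refine hd.deriv.trans ?_
  simp [oscC_zero, oscS_zero]

end

/-! ### Lifespan, uniqueness modulo rotations, and the main theorem -/

/-- A monotone periodic function is constant, so the sign condition on u₀' leaves only stationary
initial data. -/
theorem Function.Periodic.deriv_eq_zero_of_nonneg {f : ℝ → ℝ} {T : ℝ} (hT : 0 < T)
    (hf : Function.Periodic f T) (hd : Differentiable ℝ f) (h : ∀ x, 0 ≤ _root_.deriv f x) (x : ℝ) :
    _root_.deriv f x = 0 := by
  have hmono := monotone_of_deriv_nonneg hd h
  have hle : ∀ x y, f y ≤ f x := fun x y => by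
    obtain ⟨n, hn⟩ := exists_nat_ge ((y - x) / T)
    rw [div_le_iff₀ hT] at hn
    rw [← hf.nat_mul n x]
    exact hmono (by linarith)
  have hc : f = fun _ => f 0 := funext fun x => le_antisymm (hle 0 x) (hle x 0)
  rw [hc, deriv_const]

theorem exists_hsJac_pos {u₀ : ℝ → ℝ} (hu₀ : ContDiff ℝ ∞ u₀)
    (hper : Function.Periodic u₀ (2 * Real.pi)) :
    ∃ T : ℝ, 0 < T ∧ ∀ t ∈ Ioo (-T) T, ∀ x, 0 < hsJac u₀ t x := by
  obtain ⟨P, hP0, hP⟩ := hper.deriv.exists_abs_le Real.two_pi_pos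
    (contDiff_infty_iff_deriv.1 hu₀).2.continuous
  have hc : Continuous fun t => oscC (hsFreq u₀) t - |oscS (hsFreq u₀) t / 2| * P :=
    (contDiff_oscC _).continuous.sub
      ((((contDiff_oscS _).continuous).div_const 2).abs.mul continuous_const)
  have hev := (hc.continuousAt (x := 0)).eventually
    (lt_mem_nhds (a := 0) (by simp [oscC_zero, oscS_zero]))
  obtain ⟨T, hT, hTs⟩ := Metric.eventually_nhds_iff_ball.1 hev
  refine ⟨T, hT, fun t ht x => ?_⟩
  have h1 := hTs t (by rwa [Real.ball_eq_Ioo, zero_sub, zero_add])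
  have h2 : |oscS (hsFreq u₀) t / 2 * deriv u₀ x| ≤ |oscS (hsFreq u₀) t / 2| * P := by
    rw [abs_mul]
    have := hP x
    gcongr
  rw [hsJac]
  linarith [neg_abs_le (oscS (hsFreq u₀) t / 2 * deriv u₀ x)]

theorem hsJac_eq_one {u₀ : ℝ → ℝ} (h : ∀ x, deriv u₀ x = 0) (t x : ℝ) : hsJac u₀ t x = 1 := by
  have hκ : hsFreq u₀ = 0 := by simp [hsFreq, h]
  simp [hsJac, hκ, h, oscC]

/-- For κ > 0, at t = π/√κ the sine vanishes and y = -1 at every point. For κ = 0, y = 1 + t u₀'/2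
vanishes at t = -2/u₀'. -/
theorem exists_hsJac_nonpos {u₀ : ℝ → ℝ} {x : ℝ} (hx : deriv u₀ x < 0) :
    ∃ t : ℝ, 0 < t ∧ hsJac u₀ t x ≤ 0 := by
  rcases (hsFreq_nonneg u₀).eq_or_lt with h | h
  · refine ⟨-2 / deriv u₀ x, div_pos_of_neg_of_neg (by norm_num) hx, ?_⟩
    rw [hsJac, ← h]
    simp only [oscC, oscS, Real.sqrt_zero, zero_mul, Real.cos_zero, if_true]
    have := hx.ne
    field_simp
    norm_num
  · have hs := Real.sqrt_pos.2 h
    refine ⟨Real.pi / √(hsFreq u₀), div_pos Real.pi_pos hs, ?_⟩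
    simp [hsJac, oscC, oscS, h.ne', mul_div_cancel₀ _ hs.ne']

namespace IsPeriodicHSSolution

variable {I : Set ℝ} {u v : ℝ → ℝ → ℝ}

theorem mono {J : Set ℝ} (hu : IsPeriodicHSSolution I u) (h : J ⊆ I) : IsPeriodicHSSolution J u where
  smooth := hu.smooth.mono (prod_mono h subset_rfl)
  periodic t ht := hu.periodic t (h ht)
  equation t ht := hu.equation t (h ht)

theorem exists_isFlow (hI : IsOpen I) (hIc : I.OrdConnected) (h0 : (0 : ℝ) ∈ I)
    (hu : IsPeriodicHSSolution I u) : ∃ X, IsFlow I u X := by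
  obtain ⟨X, hX0, hX⟩ := hu.exists_flow hI hIc h0
  exact ⟨X, hX0, hX⟩

theorem memCircle {𝓒 : RegularityClass} (h𝓒 : 𝓒.Admissible) (hI : IsOpen I) (hIc : I.OrdConnected)
    (h0 : (0 : ℝ) ∈ I) (hu : IsPeriodicHSSolution I u) (hu₀ : 𝓒.MemCircle (u 0)) {t : ℝ}
    (ht : t ∈ I) : 𝓒.MemCircle (u t) := by
  obtain ⟨X, hX⟩ := hu.exists_isFlow hI hIc h0
  exact hu₀.of_isTransport h𝓒 (hX.isTransport hI hIc h0 hu ht)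

theorem deriv_nonneg_of_Ioi {a : ℝ} (ha : a < 0) (hu : IsPeriodicHSSolution (Ioi a) u) (x : ℝ) :
    0 ≤ deriv (u 0) x := by
  by_contra! hx
  obtain ⟨t, ht, hJ⟩ := exists_hsJac_nonpos hx
  obtain ⟨X, hX⟩ := hu.exists_isFlow isOpen_Ioi ordConnected_Ioi ha
  exact hJ.not_gt (hX.hsJac_pos isOpen_Ioi ordConnected_Ioi ha hu x (ha.trans ht))

end IsPeriodicHSSolution

/-- Bootstrap on X_t = u(t, X): if the curve is C^n, so is its derivative. -/
theorem IsFlow.contDiffOn {I : Set ℝ} {u X : ℝ → ℝ → ℝ} (hI : IsOpen I) (hu : SmoothOn I u)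
    (hX : IsFlow I u X) (x : ℝ) : ContDiffOn ℝ ∞ (fun t => X t x) I := by
  refine contDiffOn_infty.2 fun n => ?_
  have hd : DifferentiableOn ℝ (fun t => X t x) I := fun t ht =>
    (hX.hasDerivAt x t ht).differentiableAt.differentiableWithinAt
  induction n with
  | zero => exact contDiffOn_zero.2 hd.continuousOn
  | succ n ih =>
    push_cast
    refine (contDiffOn_succ_iff_deriv_of_isOpen hI).2 ⟨hd, by simp, ?_⟩
    have h1 : ContDiffOn ℝ n (fun t => u t (X t x)) I :=
      (ContDiffOn.of_le hu (by exact_mod_cast le_top)).comp (contDiffOn_id.prodMk ih)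
        fun t ht => ⟨ht, mem_univ _⟩
    exact h1.congr fun t ht => (hX.hasDerivAt x t ht).deriv

/-- Both flows are the same `hsFlow` plus the motion of the origin, so Y - X = c(t) does not depend
on the starting point. Differentiating Y = X + c in time gives the formula. -/
theorem IsPeriodicHSSolution.exists_rotation {I : Set ℝ} (hI : IsOpen I) (hIc : I.OrdConnected)
    (h0 : (0 : ℝ) ∈ I) {u v : ℝ → ℝ → ℝ} (hu : IsPeriodicHSSolution I u)
    (hv : IsPeriodicHSSolution I v) (huv : u 0 = v 0) :
    ∃ c : ℝ → ℝ, ContDiffOn ℝ ∞ c I ∧ c 0 = 0 ∧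
      ∀ t ∈ I, ∀ x : ℝ, v t x = u t (x - c t) + deriv c t := by
  obtain ⟨X, hX⟩ := hu.exists_isFlow hI hIc h0
  obtain ⟨Y, hY⟩ := hv.exists_isFlow hI hIc h0
  refine ⟨fun t => Y t 0 - X t 0,
    (hY.contDiffOn hI hv.smoothOn 0).sub (hX.contDiffOn hI hu.smoothOn 0),
    by simp [hX.zero, hY.zero], fun t ht x => ?_⟩
  obtain ⟨ξ, rfl⟩ := hY.surjective hI hIc h0 hv ht x
  have hc : ∀ s ∈ I, Y s 0 - X s 0 = Y s ξ - X s ξ := fun s hs => by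
    rw [hY.eq_hsFlow hI hIc h0 hv ξ hs, hX.eq_hsFlow hI hIc h0 hu ξ hs, huv]; ring
  have hd : deriv (fun t => Y t 0 - X t 0) t = v t (Y t ξ) - u t (X t ξ) := by
    refine (((hY.hasDerivAt ξ t ht).sub (hX.hasDerivAt ξ t ht)).congr_of_eventuallyEq ?_).deriv
    filter_upwards [hI.mem_nhds ht] with s hs using hc s hs
  simp only [hd, hc t ht, sub_sub_cancel]
  ring

theorem mainTheorem11 (𝓒 : RegularityClass) (h𝓒 : 𝓒.Admissible)
    (u₀ : ℝ → ℝ) (hu₀ : 𝓒.MemCircle u₀) :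
    -- a solution exists locally in the same space
    (∃ T : ℝ, 0 < T ∧ ∃ u : ℝ → ℝ → ℝ, IsPeriodicHSSolution (Ioo (-T) T) u ∧ u 0 = u₀ ∧
      ∀ t ∈ Ioo (-T) T, 𝓒.MemCircle (u t)) ∧
    -- every solution stays in the same space, as long as it exists
    (∀ I : Set ℝ, IsOpen I → I.OrdConnected → 0 ∈ I →
      ∀ u : ℝ → ℝ → ℝ, IsPeriodicHSSolution I u → u 0 = u₀ → ∀ t ∈ I, 𝓒.MemCircle (u t)) ∧
    -- the solution is unique modulo time-dependent rotations of the circle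
    (∀ I : Set ℝ, IsOpen I → I.OrdConnected → 0 ∈ I →
      ∀ u v : ℝ → ℝ → ℝ, IsPeriodicHSSolution I u → IsPeriodicHSSolution I v →
        u 0 = u₀ → v 0 = u₀ →
        ∃ c : ℝ → ℝ, ContDiffOn ℝ ∞ c I ∧ c 0 = 0 ∧
          ∀ t ∈ I, ∀ x : ℝ, v t x = u t (x - c t) + deriv c t) ∧
    -- a solution exists for all times `t ∈ ℝ` iff `u₀' ≥ 0`
    ((∃ u : ℝ → ℝ → ℝ, IsPeriodicHSSolution univ u ∧ u 0 = u₀ ∧ ∀ t, 𝓒.MemCircle (u t)) ↔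
      ∀ x : ℝ, 0 ≤ deriv u₀ x) ∧
    -- the same for all future times
    ((∃ a : ℝ, a < 0 ∧ ∃ u : ℝ → ℝ → ℝ, IsPeriodicHSSolution (Ioi a) u ∧ u 0 = u₀ ∧
        ∀ t ∈ Ioi a, 𝓒.MemCircle (u t)) ↔
      ∀ x : ℝ, 0 ≤ deriv u₀ x) := by
  
  have hs := hu₀.contDiff
  have hper := hu₀.1
  have hstay : ∀ I : Set ℝ, IsOpen I → I.OrdConnected → 0 ∈ I →
      ∀ u : ℝ → ℝ → ℝ, IsPeriodicHSSolution I u → u 0 = u₀ → ∀ t ∈ I, 𝓒.MemCircle (u t) :=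
    fun I hI hIc h0 u hu hu0 t ht => hu.memCircle h𝓒 hI hIc h0 (hu0 ▸ hu₀) ht
  have hglobal : (∀ x, 0 ≤ deriv u₀ x) →
      IsPeriodicHSSolution univ (hsSolution u₀) ∧ ∀ t, 𝓒.MemCircle (hsSolution u₀ t) := fun h => by
    have hz := hper.deriv_eq_zero_of_nonneg Real.two_pi_pos (hs.differentiable (by simp)) h
    have hsol := isPeriodicHSSolution_hsSolution hs hper isOpen_univ fun t _ x => by
      rw [hsJac_eq_one hz]; exact one_pos
    exact ⟨hsol, fun t => hstay univ isOpen_univ ordConnected_univ (mem_univ 0) _ hsol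
      (hsSolution_zero hs) t (mem_univ t)⟩
  refine ⟨?_, hstay, ?_, ⟨?_, ?_⟩, ⟨?_, ?_⟩⟩
  · obtain ⟨T, hT, hJ⟩ := exists_hsJac_pos hs hper
    have hsol := isPeriodicHSSolution_hsSolution hs hper isOpen_Ioo hJ
    exact ⟨T, hT, hsSolution u₀, hsol, hsSolution_zero hs,
      hstay _ isOpen_Ioo ordConnected_Ioo ⟨neg_lt_zero.2 hT, hT⟩ _ hsol (hsSolution_zero hs)⟩
  · exact fun I hI hIc h0 u v hu hv hu0 hv0 =>
      hu.exists_rotation hI hIc h0 hv (hu0.trans hv0.symm)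
  · rintro ⟨u, hu, rfl, -⟩
    exact (hu.mono (subset_univ (Ioi (-1)))).deriv_nonneg_of_Ioi neg_one_lt_zero
  · exact fun h => ⟨hsSolution u₀, (hglobal h).1, hsSolution_zero hs, (hglobal h).2⟩
  · rintro ⟨a, ha, u, hu, rfl, -⟩
    exact hu.deriv_nonneg_of_Ioi ha
  · exact fun h => ⟨-1, neg_one_lt_zero, hsSolution u₀, (hglobal h).1.mono (subset_univ _),
      hsSolution_zero hs, fun t _ => (hglobal h).2 t⟩
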